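/- Theorem (well-posedness of the pressure-robust enriched Galerkin scheme). Let $d\in\{2,3\}$ and $\sigma\in\mathbb R$. There is $\rho_0>0$, depending only on $d$ and $\sigma$, such that the following holds. Setting. Let $\Omega\subset\mathbb R^d$ be a bounded connected nonempty open set with $\operatorname{int}\overline\Omega=\Omega$ (for instance, a domain with Lipschitz boundary), and let $\mathcal T_h$ be a finite conforming mesh of $\overline\Omega$ into closed nondegenerate triangles ($d=2$) or tetrahedra ($d=3$) that is shape-regular with constant $\sigma$: every $K\in\mathcal T_h$ contains a ball of radius $r>0$ with $\operatorname{diam}K\le\sigma r$. Let $\mathcal E_h$ be the set of all edges ($d=2$) or faces ($d=3$) of the elements; $e\in\mathcal E_h$ is interior if it is shared by two different elements $K^+,K^-$, and a boundary edge/face otherwise, in which case $K^+$ denotes the element containing it. Let $n_e$ be the unit normal of $e$ pointing out of $K^+$, let $|e|$ be the length/area of $e$, and $h_e=|e|^{1/(d-1)}$. On interior $e$ put $\{v\}=\frac12(v^++v^-)$ and $[v]=v^+-v^-$, where $v^\pm$ is the trace of $v|_{K^\pm}$; on boundary $e$ put $\{v\}=[v]=v$. Let $$C_h=\{v\in[H^1_0(\Omega)]^d: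 v|_K\in[\mathbb P_1(K)]^d\ \forall K\in\mathcal T_h\},\qquad D_h=\{v: v|_K=c_K(x-x_K),\ c_K\in\mathbb R,\ \forall K\in\mathcal T_h\},$$ where $x_K$ is the centroid of $K$, and $$V_h=C_h+D_h,\qquad Q_h=\{q: q|_K\in\mathbb P_0(K)\ \forall K\in\mathcal T_h,\ \textstyle\int_\Omega q\,dx=0\},\qquad \mathrm{BDM}_1=\{w\in H(\mathrm{div},\Omega): w|_K\in[\mathbb P_1(K)]^d\ \forall K\in\mathcal T_h\}.$$ For $\nu,\rho>0$ let $$a(v,w)=\nu\Big(\sum_{K\in\mathcal T_h}\int_K\nabla v:\nabla w\,dx-\sum_{e\in\mathcal E_h}\int_e\{\nabla v\}n_e\cdot[w]\,ds-\sum_{e\in\mathcal E_h}\int_e\{\nabla w\}n_e\cdot[v]\,ds+\rho\sum_{e\in\mathcal E_h}\int_e h_e^{-1}[w]\cdot[v]\,ds\Big),$$ $$b(w,q)=\sum_{K\in\mathcal T_h}\int_K(\nabla\cdot w)\,q\,dx-\sum_{e\in\mathcal E_h}\int_e[w]\cdot n_e\,\{q\}\,ds.$$ Conclusion. (i) For every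 $v\in V_h$ there is exactly one $\mathcal Rv\in\mathrm{BDM}_1$ such that, for all $p_1\in\mathbb P_1(e)$, $\int_e\mathcal Rv\cdot n_e\,p_1\,ds=\int_e\{v\}\cdot n_e\,p_1\,ds$ on every interior $e$ and $\int_e\mathcal Rv\cdot n_e\,p_1\,ds=0$ on every boundary $e$. (ii) For all $\nu>0$, all $\rho\ge\rho_0$ and all $f\in[L^2(\Omega)]^d$ there is exactly one pair $(u_h,p_h)\in V_h\times Q_h$ such that $$a(u_h,v)-b(v,p_h)=(f,\mathcal Rv)_{L^2(\Omega)}\quad\forall v\in V_h,\qquad b(u_h,q)=0\quad\forall q\in Q_h.$$ -/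

import Mathlib

open MeasureTheory Set Filter Topology
open scoped ContDiff

noncomputable section

namespace StokesEG

/-- Euclidean space `ℝ^d`. -/
abbrev E (d : ℕ) : Type := EuclideanSpace ℝ (Fin d)

/-! ### Function spaces on an open set -/

/-- `φ ∈ C_c^∞(Ω; F)`. -/
def IsTestFunction {d : ℕ} {F : Type*} [NormedAddCommGroup F] [NormedSpace ℝ F]
    (Ω : Set (E d)) (φ : E d → F) : Prop :=
  ContDiff ℝ ∞ φ ∧ HasCompactSupport φ ∧ tsupport φ ⊆ Ω

/-- `G` is the weak gradient of the vector field `u` on `Ω`: `G x z` is the weak derivative of `u`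
in the direction `z`. -/
def IsWeakGradient {d : ℕ} (Ω : Set (E d)) (u : E d → E d) (G : E d → E d →L[ℝ] E d) : Prop :=
  ∀ φ : E d → ℝ, IsTestFunction Ω φ → ∀ z : E d,
    ∫ x in Ω, (fderiv ℝ φ x z) • u x = - ∫ x in Ω, φ x • G x z

/-- `u ∈ [H¹₀(Ω)]^d`: `u` has a weak gradient, both are square integrable on `Ω`, and `u` is a limit
in the `H¹` norm of smooth fields with compact support in `Ω`. -/
def MemH10 {d : ℕ} (Ω : Set (E d)) (u : E d → E d) : Prop :=
  MemLp u 2 (volume.restrict Ω) ∧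
  ∃ G : E d → E d →L[ℝ] E d,
    MemLp G 2 (volume.restrict Ω) ∧ IsWeakGradient Ω u G ∧
    ∃ φ : ℕ → E d → E d, (∀ n, IsTestFunction Ω (φ n)) ∧
      Tendsto (fun n => eLpNorm (fun x => φ n x - u x) 2 (volume.restrict Ω)) atTop (𝓝 0) ∧
      Tendsto (fun n => eLpNorm (fun x => fderiv ℝ (φ n) x - G x) 2 (volume.restrict Ω))
        atTop (𝓝 0)

/-- `w ∈ H(div, Ω)`: `w` and its weak divergence `g` are square integrable on `Ω`. -/
def MemHdiv {d : ℕ} (Ω : Set (E d)) (w : E d → E d) : Prop :=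
  MemLp w 2 (volume.restrict Ω) ∧
  ∃ g : E d → ℝ, MemLp g 2 (volume.restrict Ω) ∧
    ∀ φ : E d → ℝ, IsTestFunction Ω φ →
      ∫ x in Ω, fderiv ℝ φ x (w x) = - ∫ x in Ω, g x * φ x

/-! ### Simplicial meshes -/

/-- A conforming simplicial mesh of (the closure of) `Ω ⊆ ℝ^d`. An element is given by the set of
its `d + 1` affinely independent vertices; two elements meet in the simplex spanned by their common
vertices (possibly in the empty set). -/
structure Mesh (d : ℕ) (Ω : Set (E d)) where
  elems : Finset (Finset (E d))
  card_eq : ∀ K ∈ elems, K.card = d + 1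
  indep : ∀ K ∈ elems, AffineIndependent ℝ (fun x : K => (x : E d))
  inter_eq : ∀ K ∈ elems, ∀ L ∈ elems,
    convexHull ℝ (K : Set (E d)) ∩ convexHull ℝ (L : Set (E d))
      = convexHull ℝ ((K : Set (E d)) ∩ (L : Set (E d)))
  union_eq : ⋃ K ∈ elems, convexHull ℝ (K : Set (E d)) = closure Ω

namespace Mesh

variable {d : ℕ} {Ω : Set (E d)}

/-- Shape regularity with constant `σ`: every element `K` contains a ball of radius `r > 0` with
`h_K ≤ σ r`. -/
def IsShapeRegular (T : Mesh d Ω) (σ : ℝ) : Prop :=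
  ∀ K ∈ T.elems, ∃ (c : E d) (r : ℝ), 0 < r ∧
    Metric.closedBall c r ⊆ convexHull ℝ (K : Set (E d)) ∧
    Metric.diam (convexHull ℝ (K : Set (E d))) ≤ σ * r

open Classical in
/-- All edges (`d = 2`) or faces (`d = 3`) of the mesh, given by their `d` vertices. -/
def faces (T : Mesh d Ω) : Finset (Finset (E d)) :=
  T.elems.biUnion fun K => K.powersetCard d

/-- The face `e` is interior: it is shared by two different elements. The other faces are the
boundary faces. -/
def IsInterior (T : Mesh d Ω) (e : T.faces) : Prop :=
  ∃ K L : T.elems, K ≠ L ∧ e.1 ⊆ K.1 ∧ e.1 ⊆ L.1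

/-- `h_e = |e|^{1/(d-1)}`, where `|e|` is the length or area of `e`. -/
def faceSize (T : Mesh d Ω) (e : T.faces) : ℝ :=
  ((μHE[d - 1] : Measure (E d)).real (convexHull ℝ (e.1 : Set (E d)))) ^ (1 / ((d : ℝ) - 1))

/-- `∫_e g ds`, with respect to the length or area measure. -/
def faceIntegral (T : Mesh d Ω) (e : T.faces) (g : E d → ℝ) : ℝ :=
  ∫ x in convexHull ℝ (e.1 : Set (E d)), g x ∂(μHE[d - 1] : Measure (E d))

/-- `∫_K g dx`. -/
def elemIntegral (T : Mesh d Ω) (K : T.elems) (g : E d → ℝ) : ℝ :=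
  ∫ x in convexHull ℝ (K.1 : Set (E d)), g x

/-- `n` is the unit normal vector of the facet `e` of the simplex `K` that points out of `K`. -/
def IsOutwardNormal (K e : Finset (E d)) (n : E d) : Prop :=
  ‖n‖ = 1 ∧ (∀ x ∈ e, ∀ y ∈ e, inner ℝ n (x - y) = 0) ∧
    ∀ x ∈ e, ∀ a ∈ K, a ∉ e → inner ℝ n (a - x) < 0

/-- A choice, for every face `e`, of the names `K⁺`, `K⁻` of the elements that contain it and of the
unit normal `n_e`, which points out of `K⁺` (so for interior `e` from `K⁺` to `K⁻`, and for boundary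
faces out of the domain). The value of `minus` on boundary faces is never used. -/
structure Orientation (T : Mesh d Ω) where
  plus : T.faces → T.elems
  minus : T.faces → T.elems
  normal : T.faces → E d
  subset_plus : ∀ e, e.1 ⊆ (plus e).1
  subset_minus : ∀ e, e.1 ⊆ (minus e).1
  plus_ne_minus : ∀ e, T.IsInterior e → plus e ≠ minus e
  outward : ∀ e, IsOutwardNormal (plus e).1 e.1 (normal e)

/-! ### Piecewise polynomials

A piecewise polynomial function is given by its polynomial on each element; its trace from an
element `K` on a face of `K` is the value of the polynomial on `K`. -/

/-- Piecewise `[P₁]^d` vector fields. -/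
abbrev VecP1 (T : Mesh d Ω) : Type := T.elems → (E d →ᵃ[ℝ] E d)

/-- Piecewise `P₀` scalar functions. -/
abbrev ScalP0 (T : Mesh d Ω) : Type := T.elems → ℝ

open Classical in
/-- The function on `ℝ^d` that equals `g K` in the interior of each element `K` and vanishes
elsewhere (the element boundaries are a null set). -/
def glue {F : Type*} [AddCommGroup F] (T : Mesh d Ω) (g : T.elems → E d → F) : E d → F :=
  fun x => ∑ K : T.elems, (interior (convexHull ℝ (K.1 : Set (E d)))).indicator (g K) x

/-- The vector field on `ℝ^d` given by a piecewise `[P₁]^d` field. -/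
def vecFun (T : Mesh d Ω) (v : T.VecP1) : E d → E d := T.glue fun K x => v K x

/-- The function on `ℝ^d` given by a piecewise constant. -/
def scalFun (T : Mesh d Ω) (q : T.ScalP0) : E d → ℝ := T.glue fun K _ => q K

/-- The continuous velocity space `C_h`: piecewise `[P₁]^d` fields in `[H¹₀(Ω)]^d`. -/
def Ch (T : Mesh d Ω) : Set T.VecP1 := {v | MemH10 Ω (T.vecFun v)}

/-- The enrichment space `D_h`: fields that equal `c (x - x_K)` on each element `K`, where `x_K` is
the centroid of `K` and the real number `c` depends on `K`. -/
def Dh (T : Mesh d Ω) : Set T.VecP1 :=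
  {v | ∀ K : T.elems, ∃ c : ℝ, ∀ x, v K x = c • (x - K.1.centroid ℝ id)}

/-- The velocity space `V_h = C_h + D_h`. -/
def Vh (T : Mesh d Ω) : Set T.VecP1 := {v | ∃ vC ∈ T.Ch, ∃ vD ∈ T.Dh, v = vC + vD}

/-- The pressure space `Q_h`: piecewise constants with mean zero on `Ω`. -/
def Qh (T : Mesh d Ω) : Set T.ScalP0 := {q | ∫ x in Ω, T.scalFun q x = 0}

/-- The space `BDM₁`: piecewise `[P₁]^d` fields in `H(div, Ω)`. -/
def BDM1 (T : Mesh d Ω) : Set T.VecP1 := {w | MemHdiv Ω (T.vecFun w)}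

/-- The Frobenius product `∇v : ∇w` of two (constant) gradients. -/
def frob (L M : E d →ₗ[ℝ] E d) : ℝ :=
  ∑ i : Fin d, inner ℝ (L (EuclideanSpace.single i 1)) (M (EuclideanSpace.single i 1))

/-- The divergence of an affine vector field. -/
def divergence (A : E d →ᵃ[ℝ] E d) : ℝ := LinearMap.trace ℝ (E d) A.linear

namespace Orientation

variable {T : Mesh d Ω} {F : Type*} [AddCommGroup F] [Module ℝ F]

open Classical in
/-- The average on `e` of a quantity whose trace from the element `K` is `y K`. -/
def avg (O : T.Orientation) (e : T.faces) (y : T.elems → F) : F :=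
  if T.IsInterior e then (1 / 2 : ℝ) • (y (O.plus e) + y (O.minus e)) else y (O.plus e)

open Classical in
/-- The jump on `e` of a quantity whose trace from the element `K` is `y K`. -/
def jump (O : T.Orientation) (e : T.faces) (y : T.elems → F) : F :=
  if T.IsInterior e then y (O.plus e) - y (O.minus e) else y (O.plus e)

/-- `⟨{∇v} n_e, [w]⟩` over all faces. -/
def consistency (O : T.Orientation) (v w : T.VecP1) : ℝ :=
  ∑ e : T.faces, T.faceIntegral e fun x =>
    inner ℝ (O.avg e fun K => (v K).linear (O.normal e)) (O.jump e fun K => w K x)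

/-- The interior penalty bilinear form `a` with viscosity `ν` and penalty parameter `ρ`. -/
def a (O : T.Orientation) (ν ρ : ℝ) (v w : T.VecP1) : ℝ :=
  ν * ((∑ K : T.elems, T.elemIntegral K fun _ => frob (v K).linear (w K).linear)
    - O.consistency v w - O.consistency w v
    + ρ * ∑ e : T.faces, T.faceIntegral e fun x =>
        (T.faceSize e)⁻¹ * inner ℝ (O.jump e fun K => w K x) (O.jump e fun K => v K x))

/-- The bilinear form `b`. -/
def b (O : T.Orientation) (w : T.VecP1) (q : T.ScalP0) : ℝ :=
  (∑ K : T.elems, T.elemIntegral K fun _ => divergence (w K) * q K)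
    - ∑ e : T.faces, T.faceIntegral e fun x =>
        inner ℝ (O.jump e fun K => w K x) (O.normal e) * O.avg e q

/-- `w ∈ BDM₁` has the normal moments that define the reconstruction of `v`. The normal trace of `w`
on an interior face may be taken from either element, so both are required to have the moments. -/
def IsReconstruction (O : T.Orientation) (v w : T.VecP1) : Prop :=
  w ∈ T.BDM1 ∧
  (∀ e : T.faces, T.IsInterior e → ∀ K : T.elems, e.1 ⊆ K.1 → ∀ p : E d →ᵃ[ℝ] ℝ,
    T.faceIntegral e (fun x => inner ℝ (w K x) (O.normal e) * p x)
      = T.faceIntegral e (fun x =>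
          inner ℝ (O.avg e fun L => v L x) (O.normal e) * p x)) ∧
  (∀ e : T.faces, ¬ T.IsInterior e → ∀ K : T.elems, e.1 ⊆ K.1 → ∀ p : E d →ᵃ[ℝ] ℝ,
    T.faceIntegral e (fun x => inner ℝ (w K x) (O.normal e) * p x) = 0)

open Classical in
/-- The velocity reconstruction operator `𝓡`. -/
def recon (O : T.Orientation) (v : T.VecP1) : T.VecP1 :=
  if h : ∃ w, O.IsReconstruction v w then h.choose else 0

/-- `(u, p) ∈ V_h × Q_h` solves the pressure-robust enriched Galerkin scheme with body force `f`. -/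
def IsSolution (O : T.Orientation) (ν ρ : ℝ) (f : E d → E d) (u : T.VecP1) (p : T.ScalP0) : Prop :=
  u ∈ T.Vh ∧ p ∈ T.Qh ∧
  (∀ v ∈ T.Vh, O.a ν ρ u v - O.b v p = ∫ x in Ω, inner ℝ (f x) (T.vecFun (O.recon v) x)) ∧
  (∀ q ∈ T.Qh, O.b u q = 0)

end Orientation

end Mesh

end StokesEG

end

/-! The scheme is a square linear system on the finite-dimensional space V_h × Q_h, so solvability
for every load follows from uniqueness for the zero load (`existsUnique_saddle_point`). Testing the
homogeneous system with its own solution gives a(u,u) = b(u,p) = 0. It remains to see that a is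
positive definite and that b(·,p) = 0 on D_h forces p = 0; no inf-sup constant is needed. Of V_h
this uses that it is a subspace containing D_h.

Positive definiteness (`eq_zero_of_a_self`): gradients are constant on elements, so the discrete
trace inequality reduces to the geometric estimate h_e |e| ≤ C |K| with C depending on d and σ only
(`faceSize_mul_faceArea_le`). Young's inequality then absorbs the consistency terms (`a_self_ge`).
If a(v,v) = 0, then v is constant on each element and has no jumps. Since Ω is connected, any two
elements are linked through shared faces (`eq_of_face_neighbors`), and some face lies on the
boundary, so v = 0.

Pressure (`eq_of_b_bubble`): x - x_K has the same flux through every face of K (`centroid_flux`).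
For the field in D_h with coefficients q_K / |K|, elementwise integration by parts therefore turns b
into a positive multiple of the sum of squared interior jumps of q. If it vanishes, q is constant,
and zero mean gives q = 0.

Reconstruction: at a vertex of K the normals of the faces through it form a basis, so an affine
field on K is freely and uniquely determined by its normal components at the vertices of each face.
As {v}·n_e is affine, these values can be prescribed directly; the resulting normal component is
single-valued, whence H(div).

All integration by parts rests on the radial formula `integral_radial_cone` for fields f(x)(x - a)
on a cone with apex a, whose flux through the lateral boundary is zero. Splitting a vector at x into
multiples of x - a, with a running over the vertices (`eq_sum_heights`), upgrades it to the
divergence theorem on a simplex. Throughout, d = n + 1, so faces have dimension n. -/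

namespace StokesEG

/-! ### Integration over cones and hyperplane pieces -/

section Cone

variable {n : ℕ}

/-- The isometric parametrization of the hyperplane through `p` orthogonal to `N`. -/
noncomputable def hyperplaneMap (N p : E (n + 1)) (z : (Submodule.span ℝ {N})ᗮ) : E (n + 1) :=
  p + z

lemma isometry_hyperplaneMap (N p : E (n + 1)) : Isometry (hyperplaneMap N p) := by
  intro x y
  simp only [hyperplaneMap, edist_add_left]
  rfl

lemma mem_range_hyperplaneMap {N p y : E (n + 1)} :
    y ∈ range (hyperplaneMap N p) ↔ inner ℝ N (y - p) = 0 := by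
  constructor
  · rintro ⟨z, rfl⟩
    simpa [hyperplaneMap] using Submodule.mem_orthogonal_singleton_iff_inner_right.1 z.2
  · intro h
    exact ⟨⟨y - p, Submodule.mem_orthogonal_singleton_iff_inner_right.2 h⟩, by simp [hyperplaneMap]⟩

lemma finrank_orthogonal_unit {N : E (n + 1)} (hN : ‖N‖ = 1) :
    Module.finrank ℝ (Submodule.span ℝ {N})ᗮ = n := by
  have : Fact (Module.finrank ℝ (E (n + 1)) = n + 1) := ⟨by simp⟩
  exact Submodule.finrank_orthogonal_span_singleton (by rintro rfl; simp at hN)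

lemma hausdorff_eq_volume_orthogonal {N : E (n + 1)} (hN : ‖N‖ = 1) :
    (μHE[n] : Measure (Submodule.span ℝ {N})ᗮ) = volume := by
  have := InnerProductSpace.euclideanHausdorffMeasure_eq_volume (V := (Submodule.span ℝ {N})ᗮ)
  rwa [finrank_orthogonal_unit hN] at this

/-- Isometries preserve Hausdorff measure, and on the n-dimensional complement of `N` it is Lebesgue
measure. This turns face integrals into Lebesgue integrals, to which Fubini and scaling apply. -/
lemma map_hyperplaneMap {N : E (n + 1)} (hN : ‖N‖ = 1) (p : E (n + 1)) :
    (volume : Measure (Submodule.span ℝ {N})ᗮ).map (hyperplaneMap N p)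
      = (μHE[n] : Measure (E (n + 1))).restrict (range (hyperplaneMap N p)) := by
  rw [← hausdorff_eq_volume_orthogonal hN]
  exact (isometry_hyperplaneMap N p).map_euclideanHausdorffMeasure

lemma measurableEmbedding_hyperplaneMap (N p : E (n + 1)) :
    MeasurableEmbedding (hyperplaneMap N p) :=
  (isometry_hyperplaneMap N p).isClosedEmbedding.measurableEmbedding

lemma restrict_hyperplane {N : E (n + 1)} (hN : ‖N‖ = 1) (p : E (n + 1)) {S : Set (E (n + 1))}
    (hSm : MeasurableSet S) (hS : ∀ y ∈ S, inner ℝ N (y - p) = 0) :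
    (μHE[n] : Measure (E (n + 1))).restrict S
      = ((volume : Measure (Submodule.span ℝ {N})ᗮ).map (hyperplaneMap N p)).restrict S := by
  rw [map_hyperplaneMap hN, Measure.restrict_restrict hSm,
    inter_eq_left.2 fun y hy => mem_range_hyperplaneMap.2 (hS y hy)]

lemma setIntegral_hyperplane {N : E (n + 1)} (hN : ‖N‖ = 1) (p : E (n + 1)) {S : Set (E (n + 1))}
    (hSm : MeasurableSet S) (hS : ∀ y ∈ S, inner ℝ N (y - p) = 0) (f : E (n + 1) → ℝ) :
    ∫ y in S, f y ∂(μHE[n] : Measure (E (n + 1)))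
      = ∫ z in hyperplaneMap N p ⁻¹' S, f (p + z) := by
  rw [restrict_hyperplane hN p hSm hS, (measurableEmbedding_hyperplaneMap N p).setIntegral_map]
  rfl

lemma hausdorff_lt_top {N : E (n + 1)} (hN : ‖N‖ = 1) (p : E (n + 1)) {S : Set (E (n + 1))}
    (hSc : IsCompact S) (hS : ∀ y ∈ S, inner ℝ N (y - p) = 0) :
    (μHE[n] : Measure (E (n + 1))) S < ⊤ := by
  rw [← Measure.restrict_apply_self, restrict_hyperplane hN p hSc.measurableSet hS,
    Measure.restrict_apply_self, (measurableEmbedding_hyperplaneMap N p).map_apply]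
  exact ((isometry_hyperplaneMap N p).isClosedEmbedding.isCompact_preimage hSc).measure_lt_top

/-- Cartesian coordinates `(t, z) ↦ a + t N + z` along and orthogonal to the unit vector `N`. -/
noncomputable def axisMap (N a : E (n + 1)) (x : ℝ × (Submodule.span ℝ {N})ᗮ) : E (n + 1) :=
  a + x.1 • N + x.2

/-- Orthogonal splitting into the line of `N` and its complement. Because `N` has unit length, the
line is identified with ℝ without a scaling factor. -/
lemma measurePreserving_axisMap {N : E (n + 1)} (hN : ‖N‖ = 1) (a : E (n + 1)) :
    MeasurePreserving (axisMap N a) ∧ MeasurableEmbedding (axisMap N a) := by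
  have h1 := ((Submodule.span ℝ {N}).measurePreserving_measurableEquivProd a).symm
  have h2 := (LinearIsometryEquiv.toSpanUnitSingleton (𝕜 := ℝ) N hN).measurePreserving
  have h3 := h2.prod (MeasurePreserving.id (volume : Measure (Submodule.span ℝ {N})ᗮ))
  have h4 := h1.comp h3
  rw [InnerProductSpace.euclideanHausdorffMeasure_eq_volume] at h4
  have he : axisMap N a = ((Submodule.span ℝ {N}).measurableEquivProd a).symm ∘
      Prod.map (LinearIsometryEquiv.toSpanUnitSingleton (𝕜 := ℝ) N hN) id := by
    ext1 x
    simp [axisMap, add_comm, add_left_comm]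
  refine ⟨he ▸ h4, ?_⟩
  rw [he]
  refine (MeasurableEquiv.measurableEmbedding _).comp ?_
  exact ((LinearIsometryEquiv.toSpanUnitSingleton (𝕜 := ℝ) N hN).toHomeomorph.toMeasurableEquiv.prodCongr
    (MeasurableEquiv.refl _)).measurableEmbedding

/-- The cone with apex `a` over `S`. -/
def cone (a : E (n + 1)) (S : Set (E (n + 1))) : Set (E (n + 1)) :=
  (fun x : ℝ × E (n + 1) => a + x.1 • (x.2 - a)) '' (Icc 0 1 ×ˢ S)

lemma isCompact_cone (a : E (n + 1)) {S : Set (E (n + 1))} (hS : IsCompact S) :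
    IsCompact (cone a S) :=
  (isCompact_Icc.prod hS).image (by fun_prop)

-- The slice of the cone at height η s is the base scaled by s: taking the inner product with `N`
-- forces the cone parameter to equal s. The apex height s = 0 is excluded since s is inverted; it
-- is null in the integral over heights.
open Pointwise in
lemma axisMap_mem_cone {N a : E (n + 1)} (hN : ‖N‖ = 1) {η : ℝ} (hη : 0 < η) {S : Set (E (n + 1))}
    (hS : ∀ y ∈ S, inner ℝ N (y - a) = η) {s : ℝ} (hs : s ≠ 0)
    (z : (Submodule.span ℝ {N})ᗮ) :
    axisMap N a (η * s, z) ∈ cone a S ↔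
      s ∈ Ioc 0 1 ∧ z ∈ s • (hyperplaneMap N (a + η • N) ⁻¹' S) := by
  have hz (z : (Submodule.span ℝ {N})ᗮ) : inner ℝ N (z : E (n + 1)) = 0 :=
    Submodule.mem_orthogonal_singleton_iff_inner_right.1 z.2
  have hNN : inner ℝ N N = 1 := by rw [real_inner_self_eq_norm_sq, hN]; norm_num
  rw [mem_smul_set_iff_inv_smul_mem₀ hs]
  constructor
  · rintro ⟨⟨t, y⟩, ⟨ht, hy⟩, h⟩
    simp only [axisMap, add_assoc, add_right_inj] at h
    have hts : t = s := by
      have := congrArg (inner ℝ N) h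
      rw [inner_smul_right, hS y hy, inner_add_right, inner_smul_right, hNN, hz] at this
      have : t * η = s * η := by linarith
      exact mul_right_cancel₀ hη.ne' this
    subst hts
    refine ⟨⟨lt_of_le_of_ne ht.1 (Ne.symm hs), ht.2⟩, ?_⟩
    have : y = a + η • N + t⁻¹ • (z : E (n + 1)) := by
      have h' := congrArg (fun v => a + t⁻¹ • v) h
      simp only [smul_add, smul_smul, inv_mul_cancel₀ hs, one_smul, add_sub_cancel] at h'
      rw [h', add_assoc]
      congr 3
      field_simp
    simpa [hyperplaneMap, ← this] using hy
  · rintro ⟨⟨h0, h1⟩, h⟩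
    refine ⟨(s, a + η • N + s⁻¹ • (z : E (n + 1))), ⟨⟨h0.le, h1⟩, by simpa [hyperplaneMap] using h⟩, ?_⟩
    simp only [axisMap, add_assoc, add_sub_cancel_left, smul_add, smul_smul, mul_inv_cancel₀ hs,
      one_smul, mul_comm]

/-- Fubini over heights t = η s: the factor η comes from this substitution, and s ^ n from scaling
the n-dimensional slice. -/
lemma setIntegral_cone {N a : E (n + 1)} (hN : ‖N‖ = 1) {η : ℝ} (hη : 0 < η)
    {S : Set (E (n + 1))} (hSc : IsCompact S) (hS : ∀ y ∈ S, inner ℝ N (y - a) = η)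
    {g : E (n + 1) → ℝ} (hg : Continuous g) :
    ∫ x in cone a S, g x = η * ∫ s in (0 : ℝ)..1,
      ∫ z in hyperplaneMap N (a + η • N) ⁻¹' S, s ^ n * g (a + s • (η • N + (z : E (n + 1)))) := by
  obtain ⟨hmp, hme⟩ := measurePreserving_axisMap hN a
  have hKm := (isCompact_cone a hSc).measurableSet
  have hint : IntegrableOn g (cone a S) := hg.continuousOn.integrableOn_compact (isCompact_cone a hSc)
  rw [← hmp.setIntegral_preimage_emb hme, ← integral_indicator (hme.measurable hKm),
    Measure.volume_eq_prod, integral_prod]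
  swap
  · rw [integrable_indicator_iff (hme.measurable hKm)]
    exact (hmp.integrableOn_comp_preimage hme).2 hint
  set G : ℝ → ℝ := fun t => ∫ z, (axisMap N a ⁻¹' cone a S).indicator
    (fun x => g (axisMap N a x)) (t, z) with hG
  have h1 : ∫ t, G t = η * ∫ s, G (η * s) := by
    rw [Measure.integral_comp_mul_left, smul_eq_mul, abs_of_pos (inv_pos.2 hη)]
    field_simp
  rw [h1, intervalIntegral.integral_of_le zero_le_one, ← integral_indicator measurableSet_Ioc]
  congr 1
  apply integral_congr_ae
  have h0 : ∀ᵐ s : ℝ, s ≠ 0 := by simp [ae_iff]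
  filter_upwards [h0] with s hs
  have hmem := axisMap_mem_cone hN hη hS hs
  by_cases h01 : s ∈ Ioc (0 : ℝ) 1
  · simp only [hG, indicator_of_mem h01]
    have hB : MeasurableSet (hyperplaneMap N (a + η • N) ⁻¹' S) :=
      (measurableEmbedding_hyperplaneMap N _).measurable hSc.measurableSet
    have : (fun z => (axisMap N a ⁻¹' cone a S).indicator (fun x => g (axisMap N a x)) (η * s, z))
        = fun z => (hyperplaneMap N (a + η • N) ⁻¹' S).indicator
          (fun z => g (a + s • (η • N + (z : E (n + 1))))) (s⁻¹ • z) := by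
      ext z
      have : (η * s, z) ∈ axisMap N a ⁻¹' cone a S ↔
          s⁻¹ • z ∈ hyperplaneMap N (a + η • N) ⁻¹' S := by
        rw [mem_preimage, hmem, mem_smul_set_iff_inv_smul_mem₀ hs, and_iff_right h01]
      by_cases hz : s⁻¹ • z ∈ hyperplaneMap N (a + η • N) ⁻¹' S
      · rw [indicator_of_mem hz, indicator_of_mem (this.2 hz)]
        simp only [axisMap, Submodule.coe_smul, smul_add, smul_smul, mul_inv_cancel₀ hs, one_smul,
          add_assoc, mul_comm]
      · rw [indicator_of_notMem hz, indicator_of_notMem (fun h => hz (this.1 h))]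
    rw [this, Measure.integral_comp_inv_smul_of_nonneg _ _ h01.1.le, finrank_orthogonal_unit hN,
      integral_indicator hB, smul_eq_mul, integral_const_mul]
  · simp only [hG, indicator_of_notMem h01]
    rw [← integral_zero (Submodule.span ℝ {N})ᗮ ℝ]
    congr 1
    ext z
    exact indicator_of_notMem (fun h => h01 ((hmem z).1 h).1) _

/-- Integration by parts on a cone for the radial field `f(x) (x - a)`. -/
theorem integral_radial_cone {N a : E (n + 1)} (hN : ‖N‖ = 1) {η : ℝ} (hη : 0 < η)
    {S : Set (E (n + 1))} (hSc : IsCompact S) (hS : ∀ y ∈ S, inner ℝ N (y - a) = η)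
    {f : E (n + 1) → ℝ} (hf : ContDiff ℝ 1 f) :
    ∫ x in cone a S, (((n : ℝ) + 1) * f x + fderiv ℝ f x (x - a))
      = η * ∫ y in S, f y ∂(μHE[n] : Measure (E (n + 1))) := by
  have hfd : Continuous (fderiv ℝ f) := hf.continuous_fderiv one_ne_zero
  have hfc := hf.continuous
  have hp : ∀ y ∈ S, inner ℝ N (y - (a + η • N)) = 0 := by
    intro y hy
    rw [← sub_sub, inner_sub_right, hS y hy, inner_smul_right, real_inner_self_eq_norm_sq, hN]
    ring
  have hcont : Continuous fun x => ((n : ℝ) + 1) * f x + fderiv ℝ f x (x - a) := by fun_prop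
  rw [setIntegral_cone hN hη hSc hS hcont, setIntegral_hyperplane hN _ hSc.measurableSet hp]
  congr 1
  have hB : IsCompact (hyperplaneMap N (a + η • N) ⁻¹' S) :=
    (isometry_hyperplaneMap N _).isClosedEmbedding.isCompact_preimage hSc
  rw [intervalIntegral.integral_of_le zero_le_one, integral_integral_swap]
  · congr 1
    ext z
    rw [← intervalIntegral.integral_of_le zero_le_one]
    set v : E (n + 1) := η • N + z with hv
    -- Along each ray from the apex the integrand is an exact derivative. Its primitive vanishes at
    -- the apex and equals f at the base, so only the base integral survives.
    have hd : ∀ s ∈ uIcc (0 : ℝ) 1, HasDerivAt (fun s : ℝ => s ^ (n + 1) * f (a + s • v))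
        (s ^ n * (((n : ℝ) + 1) * f (a + s • v) + fderiv ℝ f (a + s • v) (a + s • v - a))) s := by
      intro s _
      have h1 : HasDerivAt (fun s : ℝ => a + s • v) v s := by
        simpa using ((hasDerivAt_id s).smul_const v).const_add a
      have h2 := ((hf.differentiable one_ne_zero) (a + s • v)).hasFDerivAt.comp_hasDerivAt s h1
      have h3 := (hasDerivAt_pow (n + 1) s).mul h2
      refine h3.congr_deriv ?_
      simp only [add_sub_cancel_left, map_smul, smul_eq_mul, Nat.cast_add, Nat.cast_one,
        Nat.add_sub_cancel, Function.comp_def]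
      ring
    rw [intervalIntegral.integral_eq_sub_of_hasDerivAt hd]
    · simp [hv, add_assoc]
    · apply Continuous.intervalIntegrable
      fun_prop
  · rw [Measure.prod_restrict]
    refine IntegrableOn.mono_set (t := Icc 0 1 ×ˢ _) ?_ (prod_mono_left Ioc_subset_Icc_self)
    refine ContinuousOn.integrableOn_compact (isCompact_Icc.prod hB) (Continuous.continuousOn ?_)
    fun_prop

end Cone

/-! ### Simplices -/

section Simplex

variable {n : ℕ}

lemma isCompact_hull (K : Finset (E (n + 1))) : IsCompact (convexHull ℝ (K : Set (E (n + 1)))) :=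
  K.finite_toSet.isCompact_convexHull ℝ

lemma measurableSet_hull (K : Finset (E (n + 1))) :
    MeasurableSet (convexHull ℝ (K : Set (E (n + 1)))) :=
  (isCompact_hull K).measurableSet

lemma affineMap_eqOn_hull {V W : Type*} [AddCommGroup V] [Module ℝ V] [AddCommGroup W] [Module ℝ W]
    {s : Set V} {A B : V →ᵃ[ℝ] W} (h : ∀ x ∈ s, A x = B x) :
    ∀ x ∈ convexHull ℝ s, A x = B x := by
  intro x hx
  have hc : Convex ℝ {x | A x = B x} := by
    intro y hy z hz s t _ _ hst
    simp only [mem_ofPred_eq] at *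
    rw [Convex.combo_affine_apply hst, Convex.combo_affine_apply hst, hy, hz]
  exact convexHull_min h hc hx

lemma inner_hull_eq {e : Finset (E (n + 1))} {N a : E (n + 1)} {η : ℝ}
    (h : ∀ y ∈ e, inner ℝ N (y - a) = η) :
    ∀ y ∈ convexHull ℝ (e : Set (E (n + 1))), inner ℝ N (y - a) = η := by
  have hc : Convex ℝ {y | inner ℝ N (y - a) = η} := by
    intro y hy z hz s t _ _ hst
    simp only [mem_ofPred_eq] at *
    have : s • y + t • z - a = s • (y - a) + t • (z - a) := by
      have : a = (s + t) • a := by rw [hst, one_smul]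
      nth_rewrite 1 [this]
      module
    rw [this, inner_add_right, inner_smul_right, inner_smul_right, hy, hz, ← add_mul, hst, one_mul]
  exact fun y hy => convexHull_min h hc hy

lemma hull_insert_eq_cone {e : Set (E (n + 1))} (he : e.Nonempty) (a : E (n + 1)) :
    convexHull ℝ (insert a e) = cone a (convexHull ℝ e) := by
  rw [convexHull_insert he, convexJoin_singleton_left]
  ext x
  simp only [mem_iUnion, segment_eq_image', cone, mem_image, mem_prod, Prod.exists]
  constructor
  · rintro ⟨y, hy, t, ht, rfl⟩
    exact ⟨t, y, ⟨ht, hy⟩, rfl⟩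
  · rintro ⟨t, y, ⟨ht, hy⟩, rfl⟩
    exact ⟨y, hy, t, ht, rfl⟩

/-- Integration by parts on a simplex for the field `f(x) (x - a)`, where `a` is a vertex. -/
theorem integral_radial_simplex {e : Finset (E (n + 1))} (he : e.Nonempty) {N a : E (n + 1)}
    {η : ℝ} (hN : ‖N‖ = 1) (hη : 0 < η) (h : ∀ y ∈ e, inner ℝ N (y - a) = η)
    {f : E (n + 1) → ℝ} (hf : ContDiff ℝ 1 f) :
    ∫ x in convexHull ℝ (insert a (e : Set (E (n + 1)))),
        (((n : ℝ) + 1) * f x + fderiv ℝ f x (x - a))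
      = η * ∫ y in convexHull ℝ (e : Set (E (n + 1))), f y ∂(μHE[n] : Measure (E (n + 1))) := by
  rw [hull_insert_eq_cone (by simpa using he)]
  exact integral_radial_cone hN hη (isCompact_hull e) (inner_hull_eq h) hf

lemma volume_simplex {e : Finset (E (n + 1))} (he : e.Nonempty) {N a : E (n + 1)}
    {η : ℝ} (hN : ‖N‖ = 1) (hη : 0 < η) (h : ∀ y ∈ e, inner ℝ N (y - a) = η) :
    ((n : ℝ) + 1) * volume.real (convexHull ℝ (insert a (e : Set (E (n + 1)))))
      = η * (μHE[n] : Measure (E (n + 1))).real (convexHull ℝ (e : Set (E (n + 1)))) := by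
  have := integral_radial_simplex he hN hη h (f := fun _ => 1) contDiff_const
  simpa [mul_comm] using this

lemma hausdorff_hull_lt_top {e : Finset (E (n + 1))} {N a : E (n + 1)} {η : ℝ} (hN : ‖N‖ = 1)
    (h : ∀ y ∈ e, inner ℝ N (y - a) = η) :
    (μHE[n] : Measure (E (n + 1))) (convexHull ℝ (e : Set (E (n + 1)))) < ⊤ := by
  refine hausdorff_lt_top hN (a + η • N) (isCompact_hull e) fun y hy => ?_
  rw [← sub_sub, inner_sub_right, inner_hull_eq h y hy, inner_smul_right,
    real_inner_self_eq_norm_sq, hN]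
  ring

/-! ### Nondegenerate simplices. -/

lemma affineSpan_simplex {K : Finset (E (n + 1))} (hc : K.card = n + 2)
    (hi : AffineIndependent ℝ (fun x : K => (x : E (n + 1)))) :
    affineSpan ℝ (K : Set (E (n + 1))) = ⊤ := by
  have := hi.affineSpan_eq_top_iff_card_eq_finrank_add_one.2 (by simp [hc])
  simpa using this

lemma interior_hull_nonempty {K : Finset (E (n + 1))} (hc : K.card = n + 2)
    (hi : AffineIndependent ℝ (fun x : K => (x : E (n + 1)))) :
    (interior (convexHull ℝ (K : Set (E (n + 1))))).Nonempty :=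
  interior_convexHull_nonempty_iff_affineSpan_eq_top.2 (affineSpan_simplex hc hi)

lemma volume_hull_pos {K : Finset (E (n + 1))} (hc : K.card = n + 2)
    (hi : AffineIndependent ℝ (fun x : K => (x : E (n + 1)))) :
    0 < volume.real (convexHull ℝ (K : Set (E (n + 1)))) :=
  ENNReal.toReal_pos (Measure.measure_pos_of_nonempty_interior _ (interior_hull_nonempty hc hi)).ne'
    (isCompact_hull K).measure_lt_top.ne

lemma closure_interior_hull {K : Finset (E (n + 1))} (hc : K.card = n + 2)
    (hi : AffineIndependent ℝ (fun x : K => (x : E (n + 1)))) :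
    closure (interior (convexHull ℝ (K : Set (E (n + 1))))) = convexHull ℝ (K : Set (E (n + 1))) := by
  rw [(convex_convexHull ℝ _).closure_interior_eq_closure_of_nonempty_interior
    (interior_hull_nonempty hc hi), (isCompact_hull K).isClosed.closure_eq]

lemma Mesh.IsOutwardNormal.exists_height {d : ℕ} {K e : Finset (E d)} {N a : E d}
    (h : Mesh.IsOutwardNormal K e N) (he : e.Nonempty) (ha : a ∈ K) (hae : a ∉ e) :
    ∃ η : ℝ, 0 < η ∧ ∀ y ∈ e, inner ℝ N (y - a) = η := by
  obtain ⟨x, hx⟩ := he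
  refine ⟨inner ℝ N (x - a), ?_, fun y hy => ?_⟩
  · have := h.2.2 x hx a ha hae
    rw [← neg_sub, inner_neg_right] at this
    linarith
  · have := h.2.1 y hy x hx
    rw [← sub_sub_sub_cancel_right y x a, inner_sub_right] at this
    linarith

/-- A square integrable affine function with vanishing `L²` norm on a facet vanishes there. -/
lemma affine_eq_zero_of_integral_sq {e : Finset (E (n + 1))} {N a : E (n + 1)}
    {η : ℝ} (he : e.Nonempty) (hN : ‖N‖ = 1) (hη : 0 < η) (h : ∀ y ∈ e, inner ℝ N (y - a) = η)
    {K : Finset (E (n + 1))} (hK : (K : Set (E (n + 1))) = insert a (e : Set (E (n + 1))))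
    (hc : K.card = n + 2) (hi : AffineIndependent ℝ (fun x : K => (x : E (n + 1))))
    (g : E (n + 1) →ᵃ[ℝ] ℝ)
    (hg : ∫ y in convexHull ℝ (e : Set (E (n + 1))), g y * g y ∂(μHE[n] : Measure (E (n + 1))) = 0) :
    ∀ y ∈ e, g y = 0 := by
  -- The extension of g from the plane of e that is linear about the apex a; it agrees with g there
  -- because ⟨N, y - a⟩ = η. As M² is homogeneous of degree two, the radial formula gives (n + 3)
  -- ∫_K M² = η ∫_e g² = 0, so M vanishes on K.
  set M : E (n + 1) →L[ℝ] ℝ :=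
    LinearMap.toContinuousLinearMap (g.linear) + (g a / η) • innerSL ℝ N with hM
  have hMe : ∀ y, inner ℝ N (y - a) = η → M (y - a) = g y := by
    intro y hy
    have h1 : g.linear (y - a) = g y - g a := by
      simpa using g.linearMap_vsub y a
    simp only [hM, add_apply, LinearMap.coe_toContinuousLinearMap', h1,
      smul_apply, innerSL_apply_apply, hy, smul_eq_mul]
    field_simp
    ring
  have hfd : ContDiff ℝ 1 fun x : E (n + 1) => M (x - a) * M (x - a) := by fun_prop
  have hder : ∀ x, fderiv ℝ (fun x : E (n + 1) => M (x - a) * M (x - a)) x (x - a)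
      = 2 * (M (x - a) * M (x - a)) := by
    intro x
    have h1 : HasFDerivAt (fun x : E (n + 1) => M (x - a)) M x := by
      exact M.hasFDerivAt.comp x ((hasFDerivAt_id x).sub_const a)
    have h2 := (h1.mul h1).fderiv
    simp only [Pi.mul_def] at h2
    rw [h2]
    simp
    ring
  have hrad := integral_radial_simplex he hN hη h hfd
  have hz : ∫ y in convexHull ℝ (e : Set (E (n + 1))), M (y - a) * M (y - a)
      ∂(μHE[n] : Measure (E (n + 1))) = 0 := by
    rw [← hg]
    refine setIntegral_congr_fun (measurableSet_hull e) fun y hy => ?_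
    simp only [hMe y (inner_hull_eq h y hy)]
  rw [hz, mul_zero, ← hK] at hrad
  simp only [hder] at hrad
  have hcont : Continuous fun x : E (n + 1) =>
      ((n : ℝ) + 1) * (M (x - a) * M (x - a)) + 2 * (M (x - a) * M (x - a)) := by fun_prop
  have hnn : ∀ x, 0 ≤ ((n : ℝ) + 1) * (M (x - a) * M (x - a)) + 2 * (M (x - a) * M (x - a)) :=
    fun x => by have := mul_self_nonneg (M (x - a)); positivity
  rw [setIntegral_eq_zero_iff_of_nonneg_ae (Eventually.of_forall hnn)
    (hcont.continuousOn.integrableOn_compact (isCompact_hull K))] at hrad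
  have hint := Measure.eqOn_open_of_ae_eq
    (ae_restrict_of_ae_restrict_of_subset interior_subset hrad) isOpen_interior
    hcont.continuousOn continuousOn_const
  have hcl := closure_minimal (s := interior (convexHull ℝ (K : Set (E (n + 1)))))
    (t := {x | M (x - a) = 0}) (fun x hx => by
      have := hint hx
      simp only [Pi.zero_apply] at this
      have h2 := mul_self_nonneg (M (x - a))
      have h3 : M (x - a) * M (x - a) = 0 := by nlinarith [Nat.cast_nonneg (α := ℝ) n]
      simpa using h3) (isClosed_eq (by fun_prop) continuous_const)
  rw [closure_interior_hull hc hi] at hcl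
  intro y hy
  rw [← hMe y (h y hy)]
  exact hcl (subset_convexHull ℝ _ (by rw [hK]; exact mem_insert_of_mem _ hy))

-- N_a / η_a is minus the gradient of the barycentric coordinate λ_a, so this is w = ∑ (w·∇λ_a) a;
-- the base point x is free because the gradients sum to zero. It suffices to check differences of
-- vertices, which span: for w = y - z only the terms a = y and a = z contribute.
open Classical in
lemma eq_sum_heights {K : Finset (E (n + 1))} (hc : K.card = n + 2)
    (hi : AffineIndependent ℝ (fun x : K => (x : E (n + 1)))) {N : E (n + 1) → E (n + 1)}
    {η : E (n + 1) → ℝ} (hη : ∀ a ∈ K, 0 < η a)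
    (h : ∀ a ∈ K, ∀ y ∈ K, y ≠ a → inner ℝ (N a) (y - a) = η a) (w x : E (n + 1)) :
    w = ∑ a ∈ K, (inner ℝ (N a) w / η a) • (x - a) := by
  have hv : vectorSpan ℝ (K : Set (E (n + 1))) = ⊤ := by
    have := hi.vectorSpan_eq_top_of_card_eq_finrank_add_one (by simp [hc])
    simpa using this
  have hw : w ∈ vectorSpan ℝ (K : Set (E (n + 1))) := hv ▸ Submodule.mem_top
  rw [vectorSpan_def] at hw
  have hya : ∀ a ∈ K, ∀ y ∈ K, inner ℝ (N a) (y - a) / η a = 1 - if a = y then (1 : ℝ) else 0 := by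
    intro a ha y hy
    by_cases hay : a = y
    · simp [hay]
    · rw [h a ha y hy (Ne.symm hay), div_self (hη a ha).ne']
      simp [hay]
  induction hw using Submodule.span_induction with
  | mem w hw =>
    obtain ⟨y, hy, z, hz, rfl⟩ := hw
    have : ∀ a ∈ K, (inner ℝ (N a) (y -ᵥ z) / η a) • (x - a)
        = (if a = z then x - a else 0) - if a = y then x - a else 0 := by
      intro a ha
      rw [vsub_eq_sub, ← sub_sub_sub_cancel_right y z a, inner_sub_right, sub_div, hya a ha y hy,
        hya a ha z hz]
      split_ifs <;> simp
    rw [Finset.sum_congr rfl this, Finset.sum_sub_distrib, Finset.sum_ite_eq', Finset.sum_ite_eq',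
      if_pos (by simpa using hz), if_pos (by simpa using hy)]
    simp
  | zero => simp
  | add u v _ _ hu hv =>
    nth_rewrite 1 [hu, hv]
    simp only [inner_add_right, add_div, add_smul, Finset.sum_add_distrib]
  | smul r u _ hu =>
    nth_rewrite 1 [hu]
    simp only [inner_smul_right, mul_div_assoc, mul_smul, Finset.smul_sum]

/-- Comparing the expansions of w about two base points, the difference is this sum times a nonzero
vector. -/
lemma sum_inner_div_height {K : Finset (E (n + 1))} (hc : K.card = n + 2)
    (hi : AffineIndependent ℝ (fun x : K => (x : E (n + 1)))) {N : E (n + 1) → E (n + 1)}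
    {η : E (n + 1) → ℝ} (hη : ∀ a ∈ K, 0 < η a)
    (h : ∀ a ∈ K, ∀ y ∈ K, y ≠ a → inner ℝ (N a) (y - a) = η a) (w : E (n + 1)) :
    ∑ a ∈ K, inner ℝ (N a) w / η a = 0 := by
  have h1 := eq_sum_heights hc hi hη h w (EuclideanSpace.single 0 1)
  have h0 := eq_sum_heights hc hi hη h w 0
  have h2 : (∑ a ∈ K, inner ℝ (N a) w / η a) • (EuclideanSpace.single 0 1 : E (n + 1)) = 0 := by
    rw [Finset.sum_smul, ← sub_eq_zero.2 (h1.symm.trans h0), ← Finset.sum_sub_distrib]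
    exact Finset.sum_congr rfl fun a _ => by module
  rcases smul_eq_zero.1 h2 with h | h
  · exact h
  · simp at h

/-- Expanding the argument of L by `eq_sum_heights` writes L as a sum of rank-one maps, whose traces
are evaluations. -/
lemma divergence_eq_sum {K : Finset (E (n + 1))} (hc : K.card = n + 2)
    (hi : AffineIndependent ℝ (fun x : K => (x : E (n + 1)))) {N : E (n + 1) → E (n + 1)}
    {η : E (n + 1) → ℝ} (hη : ∀ a ∈ K, 0 < η a)
    (h : ∀ a ∈ K, ∀ y ∈ K, y ≠ a → inner ℝ (N a) (y - a) = η a)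
    (L : E (n + 1) →ₗ[ℝ] E (n + 1)) (x : E (n + 1)) :
    LinearMap.trace ℝ (E (n + 1)) L = ∑ a ∈ K, inner ℝ (N a) (L (x - a)) / η a := by
  have hL : L = ∑ a ∈ K, ((η a)⁻¹ • (innerSL ℝ (N a)).toLinearMap).smulRight (L (x - a)) := by
    ext1 w
    nth_rewrite 1 [eq_sum_heights hc hi hη h w x]
    simp [LinearMap.sum_apply, map_sum, div_eq_inv_mul]
  nth_rewrite 1 [hL]
  rw [map_sum]
  refine Finset.sum_congr rfl fun a _ => ?_
  rw [LinearMap.trace_smulRight]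
  simp [div_eq_inv_mul]

lemma hasFDerivAt_affine (w : E (n + 1) →ᵃ[ℝ] E (n + 1)) (x : E (n + 1)) :
    HasFDerivAt (fun x => w x) (LinearMap.toContinuousLinearMap w.linear) x := by
  have : (fun x => w x) = fun x => LinearMap.toContinuousLinearMap w.linear x + w 0 := by
    ext1 x
    exact congrFun (AffineMap.decomp w) x
  rw [this]
  exact (ContinuousLinearMap.hasFDerivAt _).add_const _

lemma contDiff_affine {V : Type*} [NormedAddCommGroup V] [NormedSpace ℝ V]
    (w : E (n + 1) →ᵃ[ℝ] V) {k : WithTop ℕ∞} : ContDiff ℝ k (fun x => w x) := by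
  have : (fun x => w x) = fun x => LinearMap.toContinuousLinearMap w.linear x + w 0 := by
    ext1 x
    exact congrFun (AffineMap.decomp w) x
  rw [this]
  exact (ContinuousLinearMap.contDiff _).add contDiff_const

lemma continuous_affine {V : Type*} [NormedAddCommGroup V] [NormedSpace ℝ V]
    (w : E (n + 1) →ᵃ[ℝ] V) : Continuous (fun x => w x) :=
  (contDiff_affine w (k := 0)).continuous

open Classical in
/-- The divergence theorem on a simplex for the product of a `C¹` function and an affine field. -/
theorem divergence_theorem_simplex {K : Finset (E (n + 1))} (hc : K.card = n + 2)
    (hi : AffineIndependent ℝ (fun x : K => (x : E (n + 1)))) {N : E (n + 1) → E (n + 1)}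
    (hN : ∀ a ∈ K, Mesh.IsOutwardNormal K (K.erase a) (N a))
    (w : E (n + 1) →ᵃ[ℝ] E (n + 1)) {φ : E (n + 1) → ℝ} (hφ : ContDiff ℝ 1 φ) :
    ∫ x in convexHull ℝ (K : Set (E (n + 1))), (fderiv ℝ φ x (w x) + φ x * Mesh.divergence w)
      = ∑ a ∈ K, ∫ y in convexHull ℝ (K.erase a : Set (E (n + 1))),
          φ y * inner ℝ (w y) (N a) ∂(μHE[n] : Measure (E (n + 1))) := by
  have hne : ∀ a ∈ K, (K.erase a).Nonempty := fun a ha => by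
    rw [← Finset.card_pos, Finset.card_erase_of_mem ha, hc]; omega
  have hex : ∀ a, ∃ η : ℝ, a ∈ K → 0 < η ∧ ∀ y ∈ K.erase a, inner ℝ (N a) (y - a) = η := by
    intro a
    by_cases ha : a ∈ K
    · obtain ⟨η, h⟩ := (hN a ha).exists_height (hne a ha) ha (Finset.notMem_erase a K)
      exact ⟨η, fun _ => h⟩
    · exact ⟨0, fun h => absurd h ha⟩
  choose η hηall using hex
  have hη : ∀ a ∈ K, 0 < η a := fun a ha => (hηall a ha).1
  have h : ∀ a ∈ K, ∀ y ∈ K, y ≠ a → inner ℝ (N a) (y - a) = η a :=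
    fun a ha y hy hya => (hηall a ha).2 y (Finset.mem_erase.2 ⟨hya, hy⟩)
  have hwc := contDiff_affine w (k := 1)
  -- By `eq_sum_heights`, φ w = ∑ₐ f a · (x - a). Each summand is radial about the vertex a, so the
  -- radial formula sees only the facet opposite a.
  set f : E (n + 1) → E (n + 1) → ℝ := fun a x => φ x * (inner ℝ (N a) (w x) / η a) with hf
  have hfC : ∀ a, ContDiff ℝ 1 (f a) := fun a =>
    hφ.mul ((contDiff_const.inner ℝ hwc).div_const _)
  have hfd : ∀ a x v, fderiv ℝ (f a) x v
      = φ x * (inner ℝ (N a) (w.linear v) / η a) + fderiv ℝ φ x v * (inner ℝ (N a) (w x) / η a) := by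
    intro a x v
    have h1 := (hφ.differentiable one_ne_zero x).hasFDerivAt
    have h2 : HasFDerivAt (fun x => inner ℝ (N a) (w x) / η a)
        ((η a)⁻¹ • (innerSL ℝ (N a)).comp (LinearMap.toContinuousLinearMap w.linear)) x := by
      have := (((innerSL ℝ (N a)).hasFDerivAt (x := w x)).comp x
        (hasFDerivAt_affine w x)).const_smul (η a)⁻¹
      refine this.congr_of_eventuallyEq (Eventually.of_forall fun y => ?_)
      simp [div_eq_inv_mul]
    have h3 := (h1.mul h2).fderiv
    simp only [Pi.mul_def] at h3
    simp only [hf]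
    rw [h3]
    simp [div_eq_inv_mul]
    ring
  have hface : ∀ a ∈ K, ∫ y in convexHull ℝ (K.erase a : Set (E (n + 1))),
      φ y * inner ℝ (w y) (N a) ∂(μHE[n] : Measure (E (n + 1)))
      = ∫ x in convexHull ℝ (K : Set (E (n + 1))),
        (((n : ℝ) + 1) * f a x + fderiv ℝ (f a) x (x - a)) := by
    intro a ha
    have h1 := integral_radial_simplex (hne a ha) (hN a ha).1 (hη a ha) (hηall a ha).2 (hfC a)
    have h2 : insert a ((K.erase a : Finset (E (n + 1))) : Set (E (n + 1))) = K := by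
      rw [← Finset.coe_insert, Finset.insert_erase ha]
    rw [h2] at h1
    rw [h1, ← integral_const_mul]
    congr 1
    ext y
    have := (hη a ha).ne'
    simp only [hf, real_inner_comm (N a)]
    field_simp
  rw [Finset.sum_congr rfl hface, ← integral_finsetSum]
  · congr 1
    ext x
    have hw := eq_sum_heights hc hi hη h (w x) x
    rw [Finset.sum_add_distrib, ← Finset.mul_sum]
    -- The zeroth-order terms of the radial formulas cancel because the barycentric gradients sum to
    -- zero.
    have h0 : ∑ a ∈ K, f a x = 0 := by
      rw [hf, ← Finset.mul_sum, sum_inner_div_height hc hi hη h, mul_zero]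
    have h1 : ∑ a ∈ K, fderiv ℝ φ x (x - a) * (inner ℝ (N a) (w x) / η a) = fderiv ℝ φ x (w x) := by
      nth_rewrite 2 [hw]
      rw [map_sum]
      exact Finset.sum_congr rfl fun a _ => by rw [map_smul, smul_eq_mul, mul_comm]
    simp only [hfd, Finset.sum_add_distrib]
    rw [h0, h1, ← Finset.mul_sum, Mesh.divergence, divergence_eq_sum hc hi hη h w.linear x]
    ring
  · intro a _
    refine ContinuousOn.integrableOn_compact (isCompact_hull K) (Continuous.continuousOn ?_)
    have := (hfC a).continuous_fderiv one_ne_zero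
    have := (hfC a).continuous
    fun_prop

end Simplex

/-! ### Combinatorics of the faces of a mesh -/

section Mesh

variable {n : ℕ} {Ω : Set (E (n + 1))}

/-- The vertices of a nondegenerate simplex as an affine basis. -/
noncomputable def simplexBasis {K : Finset (E (n + 1))} (hc : K.card = n + 2)
    (hi : AffineIndependent ℝ (fun x : K => (x : E (n + 1)))) : AffineBasis K ℝ (E (n + 1)) :=
  ⟨fun x => x, hi, by
    have := affineSpan_simplex hc hi
    simpa using this⟩

lemma simplexBasis_apply {K : Finset (E (n + 1))} (hc : K.card = n + 2)
    (hi : AffineIndependent ℝ (fun x : K => (x : E (n + 1)))) (x : K) :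
    simplexBasis hc hi x = x := rfl

lemma hull_eq_nonneg_coord {K : Finset (E (n + 1))} (hc : K.card = n + 2)
    (hi : AffineIndependent ℝ (fun x : K => (x : E (n + 1)))) :
    convexHull ℝ (K : Set (E (n + 1))) = {x | ∀ i, 0 ≤ (simplexBasis hc hi).coord i x} := by
  rw [← (simplexBasis hc hi).convexHull_eq_nonneg_coord]
  congr 1
  ext x
  simp [simplexBasis_apply]

lemma notMem_affineSpan_facet {L e : Finset (E (n + 1))}
    (hi : AffineIndependent ℝ (fun x : L => (x : E (n + 1)))) (heL : e ⊆ L) {b : E (n + 1)}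
    (hb : b ∈ L) (hbe : b ∉ e) : b ∉ affineSpan ℝ (e : Set (E (n + 1))) := by
  have := (hi.mem_affineSpan_iff ⟨b, hb⟩ {i | i.1 ∈ e}).not.2 hbe
  convert this using 3
  ext x
  simp only [mem_image, Subtype.exists]
  exact ⟨fun hx => ⟨x, heL hx, hx, rfl⟩, by rintro ⟨y, _, hy, rfl⟩; exact hy⟩

lemma exists_opposite {K e : Finset (E (n + 1))} (hc : K.card = n + 2) (heK : e ⊆ K)
    (hce : e.card = n + 1) :
    ∃ a ∈ K, a ∉ e ∧ (K : Set (E (n + 1))) = insert a (e : Set (E (n + 1))) := by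
  classical
  obtain ⟨a, hae, rfl⟩ : ∃ a, a ∉ e ∧ insert a e = K :=
    Finset.covBy_iff_exists_insert.1 ((Finset.covBy_iff_card_sdiff_eq_one).2 ⟨heK, by
      rw [Finset.card_sdiff_of_subset heK]; omega⟩)
  exact ⟨a, Finset.mem_insert_self _ _, hae, by simp⟩

/-- If `e` is a facet of two simplices that meet only in `e`, they lie on different sides of `e`. -/
lemma outwardNormal_neg {K L e : Finset (E (n + 1))} (hcK : K.card = n + 2)
    (hiK : AffineIndependent ℝ (fun x : K => (x : E (n + 1))))
    (hiL : AffineIndependent ℝ (fun x : L => (x : E (n + 1))))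
    (heK : e ⊆ K) (heL : e ⊆ L) (hce : e.card = n + 1)
    (hKL : convexHull ℝ (K : Set (E (n + 1))) ∩ convexHull ℝ (L : Set (E (n + 1)))
      ⊆ convexHull ℝ (e : Set (E (n + 1)))) {N : E (n + 1)} (hN : Mesh.IsOutwardNormal K e N) :
    Mesh.IsOutwardNormal L e (-N) := by
  classical
  refine ⟨by rw [norm_neg, hN.1], fun x hx y hy => by rw [inner_neg_left, hN.2.1 x hx y hy, neg_zero],
    fun x hx b hb hbe => ?_⟩
  rw [inner_neg_left, neg_lt_zero]
  -- Suppose b is on the side of K, or in the plane of e. Moving from the centroid z of e slightly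
  -- towards b stays in K: the coordinates at vertices of e are positive at z, and the remaining one
  -- is zero at z and nonnegative at b. The moved point is also in L, hence in e, and the line
  -- through it and z puts b in the affine span of e.
  by_contra hcon
  push Not at hcon
  obtain ⟨a, ha, hae, hKa⟩ := exists_opposite hcK heK hce
  set B := simplexBasis hcK hiK with hB
  set s : Finset K := Finset.univ.filter fun i => i.1 ∈ e with hs
  have hsne : s.Nonempty := ⟨⟨x, heK hx⟩, by simp [hs, hx]⟩
  set z := s.centroid ℝ B with hz
  have hze : z ∈ convexHull ℝ (e : Set (E (n + 1))) := by
    rw [hz, Finset.centroid_eq_centerMass _ hsne]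
    refine Finset.centerMass_mem_convexHull _ (fun i _ => by simp [Finset.centroidWeights]) ?_ ?_
    · rw [s.sum_centroidWeights_eq_one_of_nonempty ℝ hsne]; exact one_pos
    · intro i hi
      exact (Finset.mem_filter.1 hi).2
  have hcz : ∀ i : K, i.1 ∈ e → 0 < B.coord i z := fun i hi => by
    rw [hz, B.coord_apply_centroid (by simp [hs, hi])]
    have := hsne.card_pos
    positivity
  have hcz0 : ∀ i : K, i.1 ∉ e → B.coord i z = 0 := fun i hi => by
    rw [hz, Finset.centroid_def]
    exact B.coord_apply_combination_of_notMem (by simp [hs, hi])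
      (s.sum_centroidWeights_eq_one_of_nonempty ℝ hsne)
  have hba : ∀ i : K, i.1 ∉ e → 0 ≤ B.coord i b := fun i hi => by
    have hsum : inner ℝ N (b - x) = B.coord i b * inner ℝ N (i.1 - x) := by
      have h1 : b - x = ∑ j, B.coord j b • ((j : E (n + 1)) - x) := by
        simp only [smul_sub, Finset.sum_sub_distrib, ← Finset.sum_smul, B.sum_coord_apply_eq_one,
          one_smul]
        congr 1
        exact (B.linear_combination_coord_eq_self b).symm
      rw [h1, inner_sum, Finset.sum_eq_single i]
      · rw [inner_smul_right]
      · intro j _ hji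
        have : j.1 ∈ e := by
          have hja : j.1 ∈ insert a (e : Set (E (n + 1))) := hKa ▸ j.2
          have hia : i.1 ∈ insert a (e : Set (E (n + 1))) := hKa ▸ i.2
          rcases hja with h | h
          · rcases hia with h' | h'
            · exact absurd (Subtype.ext (h.trans h'.symm)) hji
            · exact absurd h' hi
          · exact h
        rw [inner_smul_right, hN.2.1 _ this x hx, mul_zero]
      · simp
    have hneg := hN.2.2 x hx i.1 i.2 hi
    by_contra h
    push Not at h
    have := mul_pos_of_neg_of_neg h hneg
    linarith
  have hev : ∀ᶠ t : ℝ in 𝓝[>] 0, ∀ i : K, 0 ≤ B.coord i (AffineMap.lineMap z b t) := by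
    rw [eventually_all]
    intro i
    have hline : ∀ t : ℝ, B.coord i (AffineMap.lineMap z b t)
        = (1 - t) * B.coord i z + t * B.coord i b := fun t => by
      rw [AffineMap.apply_lineMap, AffineMap.lineMap_apply_ring]
    simp only [hline]
    by_cases hi : i.1 ∈ e
    · have ht : Tendsto (fun t : ℝ => (1 - t) * B.coord i z + t * B.coord i b) (𝓝[>] 0)
          (𝓝 ((1 - 0) * B.coord i z + 0 * B.coord i b)) :=
        (Continuous.tendsto (by fun_prop) 0).mono_left nhdsWithin_le_nhds
      have h0 : 0 < (1 - 0) * B.coord i z + 0 * B.coord i b := by simpa using hcz i hi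
      exact (ht.eventually (lt_mem_nhds h0)).mono fun t ht => le_of_lt ht
    · filter_upwards [self_mem_nhdsWithin] with t ht
      rw [hcz0 i hi, mul_zero, zero_add]
      exact mul_nonneg (le_of_lt ht) (hba i hi)
  obtain ⟨t, ht, ht0, ht1⟩ := (hev.and (Ioo_mem_nhdsGT (zero_lt_one' ℝ))).exists
  have hpK : AffineMap.lineMap z b t ∈ convexHull ℝ (K : Set (E (n + 1))) := by
    rw [hull_eq_nonneg_coord hcK hiK]; exact ht
  have hpL : AffineMap.lineMap z b t ∈ convexHull ℝ (L : Set (E (n + 1))) :=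
    (convex_convexHull ℝ _).lineMap_mem (convexHull_mono (by exact_mod_cast heL) hze)
      (subset_convexHull ℝ _ hb) ⟨ht0.le, le_of_lt ht1⟩
  have hpe := convexHull_subset_affineSpan _ (hKL ⟨hpK, hpL⟩)
  refine notMem_affineSpan_facet hiL heL hb hbe ?_
  have := AffineMap.lineMap_mem t⁻¹ (convexHull_subset_affineSpan _ hze) hpe
  rwa [AffineMap.lineMap_lineMap_right, inv_mul_cancel₀ ht0.ne', AffineMap.lineMap_apply_one] at this

namespace Mesh

variable (T : Mesh (n + 1) Ω)

lemma mem_faces {e : Finset (E (n + 1))} :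
    e ∈ T.faces ↔ ∃ K ∈ T.elems, e ⊆ K ∧ e.card = n + 1 := by
  simp [faces, Finset.mem_powersetCard]

variable {T}

lemma card_face (e : T.faces) : e.1.card = n + 1 := by
  obtain ⟨K, _, _, h⟩ := T.mem_faces.1 e.2
  exact h

lemma face_nonempty (e : T.faces) : e.1.Nonempty := by
  rw [← Finset.card_pos, card_face]; omega

lemma card_elem (K : T.elems) : K.1.card = n + 2 := T.card_eq K.1 K.2

lemma indep_elem (K : T.elems) : AffineIndependent ℝ (fun x : K.1 => (x : E (n + 1))) :=
  T.indep K.1 K.2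

/-- Distinct elements share at most n + 1 of their n + 2 vertices, so a common face already contains
all shared vertices, and conformity identifies the intersection. -/
lemma hull_inter_subset {e : Finset (E (n + 1))} (hce : e.card = n + 1) {K L : T.elems}
    (hKL : K ≠ L) (heK : e ⊆ K.1) (heL : e ⊆ L.1) :
    convexHull ℝ (K.1 : Set (E (n + 1))) ∩ convexHull ℝ (L.1 : Set (E (n + 1)))
      ⊆ convexHull ℝ (e : Set (E (n + 1))) := by
  classical
  rw [T.inter_eq K.1 K.2 L.1 L.2, ← Finset.coe_inter]
  refine convexHull_mono (Finset.coe_subset.2 ?_)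
  have h1 : e ⊆ K.1 ∩ L.1 := Finset.subset_inter heK heL
  have h2 : (K.1 ∩ L.1).card ≤ n + 1 := by
    by_contra h
    push Not at h
    have h3 : K.1 ∩ L.1 = K.1 := Finset.eq_of_subset_of_card_le Finset.inter_subset_left
      (by rw [card_elem]; omega)
    have h4 : K.1 ∩ L.1 = L.1 := Finset.eq_of_subset_of_card_le Finset.inter_subset_right
      (by rw [card_elem]; omega)
    exact hKL (Subtype.ext (h3.symm.trans h4))
  exact (Finset.eq_of_subset_of_card_le h1 (by omega)).ge

lemma isOutwardNormal_neg {e : T.faces} {K L : T.elems} (hKL : K ≠ L) (heK : e.1 ⊆ K.1)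
    (heL : e.1 ⊆ L.1) {N : E (n + 1)} (hN : IsOutwardNormal K.1 e.1 N) :
    IsOutwardNormal L.1 e.1 (-N) :=
  outwardNormal_neg (card_elem K) (indep_elem K) (indep_elem L) heK heL (card_face e)
    (hull_inter_subset (card_face e) hKL heK heL) hN

lemma not_isOutwardNormal_neg {e : T.faces} {K : T.elems} (heK : e.1 ⊆ K.1) {N : E (n + 1)}
    (hN : IsOutwardNormal K.1 e.1 N) : ¬ IsOutwardNormal K.1 e.1 (-N) := by
  intro h
  obtain ⟨a, ha, hae, -⟩ := exists_opposite (card_elem K) heK (card_face e)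
  obtain ⟨x, hx⟩ := face_nonempty e
  have h1 := h.2.2 x hx a ha hae
  have h2 := hN.2.2 x hx a ha hae
  rw [inner_neg_left] at h1
  linarith

/-! ### Outward normals and the one or two elements containing a face. -/

namespace Orientation

variable (O : T.Orientation)

open Classical in
/-- The unit normal of the face `e` of `K` that points out of `K`. -/
noncomputable def outNormal (K : T.elems) (e : T.faces) : E (n + 1) :=
  if K = O.plus e then O.normal e else -O.normal e

lemma isOutwardNormal_outNormal {K : T.elems} {e : T.faces} (h : e.1 ⊆ K.1) :
    IsOutwardNormal K.1 e.1 (O.outNormal K e) := by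
  unfold outNormal
  split_ifs with hK
  · rw [hK]; exact O.outward e
  · exact isOutwardNormal_neg (Ne.symm hK) (O.subset_plus e) h (O.outward e)

/-- A third element on the face would lie opposite to both `plus` and `minus`, so both `-N` and `N`
would point out of it. -/
lemma eq_plus_or_minus {K : T.elems} {e : T.faces} (hint : T.IsInterior e) (h : e.1 ⊆ K.1) :
    K = O.plus e ∨ K = O.minus e := by
  by_contra hcon
  push Not at hcon
  have h1 := isOutwardNormal_neg (O.plus_ne_minus e hint) (O.subset_plus e) (O.subset_minus e)
    (O.outward e)
  have h2 := isOutwardNormal_neg (Ne.symm hcon.2) (O.subset_minus e) h h1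
  have h3 := isOutwardNormal_neg (Ne.symm hcon.1) (O.subset_plus e) h (O.outward e)
  rw [neg_neg] at h2
  exact not_isOutwardNormal_neg h h2 h3

lemma eq_plus {K : T.elems} {e : T.faces} (hint : ¬ T.IsInterior e) (h : e.1 ⊆ K.1) :
    K = O.plus e := by
  by_contra hcon
  exact hint ⟨K, O.plus e, hcon, h, O.subset_plus e⟩

lemma outNormal_plus (e : T.faces) : O.outNormal (O.plus e) e = O.normal e := by
  simp [outNormal]

lemma outNormal_minus {e : T.faces} (hint : T.IsInterior e) :
    O.outNormal (O.minus e) e = -O.normal e := by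
  simp [outNormal, (O.plus_ne_minus e hint).symm]

-- Used twice: to assemble elementwise boundary terms into jumps, and to charge face contributions
-- to elements in the coercivity estimate.
open Classical in
lemma sum_elems_faces {M : Type*} [AddCommMonoid M] (Ψ : T.elems → T.faces → M) :
    ∑ K : T.elems, ∑ e : T.faces with e.1 ⊆ K.1, Ψ K e
      = ∑ e : T.faces, (Ψ (O.plus e) e + if T.IsInterior e then Ψ (O.minus e) e else 0) := by
  simp only [Finset.sum_filter]
  rw [Finset.sum_comm]
  refine Finset.sum_congr rfl fun e _ => ?_
  rw [← Finset.sum_filter]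
  by_cases hint : T.IsInterior e
  · have : (Finset.univ.filter fun K : T.elems => e.1 ⊆ K.1) = {O.plus e, O.minus e} := by
      ext K
      simp only [Finset.mem_filter, Finset.mem_univ, true_and, Finset.mem_insert,
        Finset.mem_singleton]
      constructor
      · exact O.eq_plus_or_minus hint
      · rintro (rfl | rfl)
        · exact O.subset_plus e
        · exact O.subset_minus e
    rw [this, Finset.sum_pair (O.plus_ne_minus e hint), if_pos hint]
  · have : (Finset.univ.filter fun K : T.elems => e.1 ⊆ K.1) = {O.plus e} := by
      ext K
      simp only [Finset.mem_filter, Finset.mem_univ, true_and, Finset.mem_singleton]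
      constructor
      · exact O.eq_plus hint
      · rintro rfl
        exact O.subset_plus e
    rw [this, Finset.sum_singleton, if_neg hint, add_zero]

end Orientation

open Classical in
/-- Faces of an element correspond to its vertices. -/
lemma sum_vertices_eq_sum_faces {M : Type*} [AddCommMonoid M] (K : T.elems)
    (G : Finset (E (n + 1)) → M) :
    ∑ a ∈ K.1, G (K.1.erase a) = ∑ e : T.faces with e.1 ⊆ K.1, G e.1 := by
  have hface : ∀ a ∈ K.1, K.1.erase a ∈ T.faces := fun a ha =>
    T.mem_faces.2 ⟨K.1, K.2, Finset.erase_subset _ _, by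
      rw [Finset.card_erase_of_mem ha, card_elem]; rfl⟩
  refine Finset.sum_bij (fun a ha => ⟨K.1.erase a, hface a ha⟩) ?_ ?_ ?_ ?_
  · intro a ha
    simp [Finset.erase_subset]
  · intro a ha b hb hab
    exact Finset.erase_injOn K.1 ha hb (Subtype.ext_iff.1 hab)
  · intro e he
    obtain ⟨a, ha, hae, hK⟩ := exists_opposite (card_elem K) (Finset.mem_filter.1 he).2 (card_face e)
    refine ⟨a, ha, Subtype.ext ?_⟩
    have : K.1 = insert a e.1 := by
      apply Finset.coe_injective
      rw [hK, Finset.coe_insert]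
    simp only [this]
    exact Finset.erase_insert hae
  · intro a ha
    rfl

open Classical in
lemma card_faces_of_elem (K : T.elems) :
    (Finset.univ.filter fun e : T.faces => e.1 ⊆ K.1).card = n + 2 := by
  have := sum_vertices_eq_sum_faces K (fun _ => 1)
  rw [Finset.card_eq_sum_ones, ← this, ← Finset.card_eq_sum_ones, card_elem]

/-- The outward normal determines a positive height of the opposite vertex. -/
lemma exists_height {K : T.elems} {e : T.faces} (heK : e.1 ⊆ K.1) {N : E (n + 1)}
    (hN : IsOutwardNormal K.1 e.1 N) :
    ∃ a ∈ K.1, a ∉ e.1 ∧ (K.1 : Set (E (n + 1))) = insert a (e.1 : Set (E (n + 1))) ∧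
      ∃ η : ℝ, 0 < η ∧ ∀ y ∈ e.1, inner ℝ N (y - a) = η := by
  obtain ⟨a, ha, hae, hK⟩ := exists_opposite (card_elem K) heK (card_face e)
  exact ⟨a, ha, hae, hK, hN.exists_height (face_nonempty e) ha hae⟩

/-! ### Measures and integrals on faces and elements. -/

lemma faceIntegral_eq (e : T.faces) (g : E (n + 1) → ℝ) :
    T.faceIntegral e g = ∫ x in convexHull ℝ (e.1 : Set (E (n + 1))), g x
      ∂(μHE[n] : Measure (E (n + 1))) := rfl

lemma faceMeasure_lt_top (O : T.Orientation) (e : T.faces) :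
    (μHE[n] : Measure (E (n + 1))) (convexHull ℝ (e.1 : Set (E (n + 1)))) < ⊤ := by
  obtain ⟨a, ha, hae, hK, η, hη, h⟩ := exists_height (O.subset_plus e) (O.outward e)
  exact hausdorff_hull_lt_top (O.outward e).1 h

lemma integrableOn_face (O : T.Orientation) (e : T.faces) {V : Type*} [NormedAddCommGroup V]
    {g : E (n + 1) → V} (hg : Continuous g) [SecondCountableTopologyEither (E (n + 1)) V] :
    IntegrableOn g (convexHull ℝ (e.1 : Set (E (n + 1)))) (μHE[n] : Measure (E (n + 1))) := by
  obtain ⟨C, hC⟩ := (isCompact_hull e.1).exists_bound_of_continuousOn hg.continuousOn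
  exact Measure.integrableOn_of_bounded (faceMeasure_lt_top O e).ne hg.aestronglyMeasurable
    (ae_restrict_of_forall_mem (measurableSet_hull e.1) hC)

lemma faceIntegral_add (O : T.Orientation) (e : T.faces) {f g : E (n + 1) → ℝ} (hf : Continuous f)
    (hg : Continuous g) :
    T.faceIntegral e (fun x => f x + g x) = T.faceIntegral e f + T.faceIntegral e g :=
  integral_add (integrableOn_face O e hf) (integrableOn_face O e hg)

lemma faceIntegral_const_mul (e : T.faces) (c : ℝ) (f : E (n + 1) → ℝ) :
    T.faceIntegral e (fun x => c * f x) = c * T.faceIntegral e f :=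
  integral_const_mul _ _

lemma faceIntegral_congr {e : T.faces} {f g : E (n + 1) → ℝ}
    (h : ∀ x ∈ convexHull ℝ (e.1 : Set (E (n + 1))), f x = g x) :
    T.faceIntegral e f = T.faceIntegral e g :=
  setIntegral_congr_fun (measurableSet_hull e.1) h

/-- The area of a face. -/
noncomputable def faceArea (T : Mesh (n + 1) Ω) (e : T.faces) : ℝ :=
  (μHE[n] : Measure (E (n + 1))).real (convexHull ℝ (e.1 : Set (E (n + 1))))

/-- The volume of an element. -/
noncomputable def elemVol (T : Mesh (n + 1) Ω) (K : T.elems) : ℝ :=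
  volume.real (convexHull ℝ (K.1 : Set (E (n + 1))))

lemma faceIntegral_const (e : T.faces) (c : ℝ) :
    T.faceIntegral e (fun _ => c) = T.faceArea e * c := by
  rw [faceIntegral_eq, setIntegral_const, smul_eq_mul]; rfl

lemma elemIntegral_const (K : T.elems) (c : ℝ) :
    T.elemIntegral K (fun _ => c) = T.elemVol K * c := by
  rw [elemIntegral, setIntegral_const, smul_eq_mul]; rfl

lemma elemVol_pos (K : T.elems) : 0 < T.elemVol K := volume_hull_pos (card_elem K) (indep_elem K)

/-- `(n + 1) |K| = height * |e|`. -/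
lemma elemVol_eq {K : T.elems} {e : T.faces} {a N : E (n + 1)} {η : ℝ} (hN : ‖N‖ = 1)
    (hK : (K.1 : Set (E (n + 1))) = insert a (e.1 : Set (E (n + 1)))) (hη : 0 < η)
    (h : ∀ y ∈ e.1, inner ℝ N (y - a) = η) :
    ((n : ℝ) + 1) * T.elemVol K = η * T.faceArea e := by
  have := volume_simplex (face_nonempty e) hN hη h
  rwa [← hK] at this

lemma faceArea_pos (O : T.Orientation) (e : T.faces) : 0 < T.faceArea e := by
  obtain ⟨a, ha, hae, hK, η, hη, h⟩ := exists_height (O.subset_plus e) (O.outward e)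
  have h1 := elemVol_eq (O.outward e).1 hK hη h
  have h2 := elemVol_pos (O.plus e)
  have h3 : 0 < η * T.faceArea e := by rw [← h1]; positivity
  exact pos_of_mul_pos_right h3 hη.le

lemma continuous_jump (O : T.Orientation) (w : T.VecP1) (e : T.faces) :
    Continuous fun x => O.jump e fun K => w K x := by
  unfold Orientation.jump
  have := fun K => continuous_affine (w K)
  split_ifs
  · exact (this _).sub (this _)
  · exact this _

lemma continuous_avg (O : T.Orientation) (w : T.VecP1) (e : T.faces) :
    Continuous fun x => O.avg e fun K => w K x := by
  unfold Orientation.avg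
  have := fun K => continuous_affine (w K)
  split_ifs
  · exact ((this _).add (this _)).const_smul (1 / 2 : ℝ)
  · exact this _

/-- Elementwise integration by parts for piecewise affine fields. -/
theorem sum_integral_by_parts (O : T.Orientation) (w : T.VecP1) {φ : E (n + 1) → ℝ}
    (hφ : ContDiff ℝ 1 φ) :
    ∑ K : T.elems, T.elemIntegral K (fun x => fderiv ℝ φ x (w K x) + φ x * divergence (w K))
      = ∑ e : T.faces, T.faceIntegral e fun x =>
          φ x * inner ℝ (O.jump e fun K => w K x) (O.normal e) := by
  classical
  have hK : ∀ K : T.elems,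
      T.elemIntegral K (fun x => fderiv ℝ φ x (w K x) + φ x * divergence (w K))
      = ∑ e : T.faces with e.1 ⊆ K.1,
          T.faceIntegral e fun x => φ x * inner ℝ (w K x) (O.outNormal K e) := by
    intro K
    -- Normals as a function of bare vertex sets, extended by zero, since the divergence theorem on
    -- a simplex indexes facets by the opposite vertex.
    let N : Finset (E (n + 1)) → E (n + 1) := fun e =>
      if he : e ∈ T.faces then O.outNormal K ⟨e, he⟩ else 0
    have hNe : ∀ e : T.faces, N e.1 = O.outNormal K e := fun e => by simp [N]
    rw [elemIntegral, divergence_theorem_simplex (card_elem K) (indep_elem K)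
      (N := fun a => N (K.1.erase a)) _ (w K) hφ]
    · rw [← Finset.sum_congr rfl fun a ha => ?_]
      · exact (sum_vertices_eq_sum_faces K fun e => ∫ y in convexHull ℝ (e : Set (E (n + 1))),
          φ y * inner ℝ (w K y) (N e) ∂(μHE[n] : Measure (E (n + 1)))).trans
          (Finset.sum_congr rfl fun e _ => by rw [hNe]; rfl)
      · simp
    · intro a ha
      have hf : K.1.erase a ∈ T.faces :=
        T.mem_faces.2 ⟨K.1, K.2, Finset.erase_subset _ _, by
          rw [Finset.card_erase_of_mem ha, card_elem]; rfl⟩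
      simp only [N, dif_pos hf]
      exact O.isOutwardNormal_outNormal (e := ⟨_, hf⟩) (Finset.erase_subset _ _)
  rw [Finset.sum_congr rfl fun K _ => hK K, O.sum_elems_faces]
  refine Finset.sum_congr rfl fun e _ => ?_
  have hφc := hφ.continuous
  have hw := fun K => continuous_affine (w K)
  simp only [Orientation.jump, O.outNormal_plus]
  split_ifs with hint
  · rw [O.outNormal_minus hint, ← faceIntegral_add O e (by fun_prop) (by fun_prop)]
    congr 1
    ext x
    rw [inner_neg_right, inner_sub_left]
    ring
  · rw [add_zero]

end Mesh

end Mesh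

/-! ### Connectivity of the mesh through faces -/

section Connectivity

variable {n : ℕ} {Ω : Set (E (n + 1))}

lemma affineSpan_ne_top_of_card_le {s : Finset (E (n + 1))} (hs : s.card ≤ n + 1) :
    affineSpan ℝ (s : Set (E (n + 1))) ≠ ⊤ := by
  classical
  intro h
  rcases s.eq_empty_or_nonempty with rfl | hne
  · simp at h
  · have h1 := finrank_vectorSpan_image_finset_le ℝ (id : E (n + 1) → E (n + 1)) s
      (n := s.card - 1) (by have := hne.card_pos; omega)
    rw [Finset.image_id, ← direction_affineSpan, h, AffineSubspace.direction_top, finrank_top] at h1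
    simp at h1
    omega

/-- Finitely many proper affine subspaces form a null set; a nonempty open set is not null. -/
lemma exists_mem_open_notMem_affineSubspaces {ι : Type*} [Finite ι] {U : Set (E (n + 1))}
    (hU : IsOpen U) (hne : U.Nonempty) (M : ι → AffineSubspace ℝ (E (n + 1)))
    (hM : ∀ i, M i ≠ ⊤) : ∃ x ∈ U, ∀ i, x ∉ M i := by
  by_contra hcon
  push Not at hcon
  have hsub : U ⊆ ⋃ i, (M i : Set (E (n + 1))) := fun x hx => mem_iUnion.2 (hcon x hx)
  have h0 : volume (⋃ i, (M i : Set (E (n + 1)))) = 0 :=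
    measure_iUnion_null fun i => Measure.addHaar_affineSubspace _ _ (hM i)
  exact (hU.measure_pos volume hne).ne' (measure_mono_null hsub h0)

namespace Mesh

variable {T : Mesh (n + 1) Ω}

lemma hull_subset_closure (K : T.elems) : convexHull ℝ (K.1 : Set (E (n + 1))) ⊆ closure Ω := by
  rw [← T.union_eq]
  exact subset_biUnion_of_mem (u := fun K : Finset (E (n + 1)) => convexHull ℝ (K : Set (E (n + 1))))
    K.2

lemma interior_hull_subset (hΩ : interior (closure Ω) = Ω) (K : T.elems) :
    interior (convexHull ℝ (K.1 : Set (E (n + 1)))) ⊆ Ω :=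
  (interior_mono (hull_subset_closure K)).trans hΩ.le

/-- A function on the elements of a mesh of a connected domain is constant if it takes the same
value on any two elements that share a face. -/
theorem eq_of_face_neighbors (hopen : IsOpen Ω) (hconn : IsConnected Ω)
    (hΩ : interior (closure Ω) = Ω) {X : Type*} {g : T.elems → X}
    (hg : ∀ (e : T.faces) (K L : T.elems), e.1 ⊆ K.1 → e.1 ⊆ L.1 → g K = g L) (K₀ L₀ : T.elems) :
    g K₀ = g L₀ := by
  classical
  by_contra hne
  let A : Set (E (n + 1)) := ⋃ K : {K : T.elems // g K = g K₀},
    convexHull ℝ (K.1.1 : Set (E (n + 1)))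
  let B : Set (E (n + 1)) := ⋃ K : {K : T.elems // g K ≠ g K₀},
    convexHull ℝ (K.1.1 : Set (E (n + 1)))
  have hA : IsClosed A := isClosed_iUnion_of_finite fun K => (isCompact_hull _).isClosed
  have hB : IsClosed B := isClosed_iUnion_of_finite fun K => (isCompact_hull _).isClosed
  have hAB : Ω ⊆ A ∪ B := by
    intro x hx
    have := T.union_eq.ge (subset_closure hx)
    simp only [mem_iUnion] at this
    obtain ⟨K, hK, hxK⟩ := this
    by_cases h : g ⟨K, hK⟩ = g K₀
    · exact Or.inl (mem_iUnion.2 ⟨⟨⟨K, hK⟩, h⟩, hxK⟩)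
    · exact Or.inr (mem_iUnion.2 ⟨⟨⟨K, hK⟩, h⟩, hxK⟩)
  have hinA : (Ω ∩ A).Nonempty := by
    obtain ⟨x, hx⟩ := interior_hull_nonempty (card_elem K₀) (indep_elem K₀)
    exact ⟨x, interior_hull_subset hΩ K₀ hx, mem_iUnion.2 ⟨⟨K₀, rfl⟩, interior_subset hx⟩⟩
  have hinB : (Ω ∩ B).Nonempty := by
    obtain ⟨x, hx⟩ := interior_hull_nonempty (card_elem L₀) (indep_elem L₀)
    exact ⟨x, interior_hull_subset hΩ L₀ hx,
      mem_iUnion.2 ⟨⟨L₀, fun h => hne h.symm⟩, interior_subset hx⟩⟩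
  -- The elements with value g K₀ and the others form two closed sets that cover the connected Ω and
  -- both meet it, so they touch at some z in Ω.
  obtain ⟨z, hzΩ, hzA, hzB⟩ :=
    isPreconnected_closed_iff.1 hconn.isPreconnected A B hA hB hAB hinA hinB
  obtain ⟨⟨K, hK⟩, hzK⟩ := mem_iUnion.1 hzA
  obtain ⟨⟨L, hL⟩, hzL⟩ := mem_iUnion.1 hzB
  obtain ⟨r, hr, hball⟩ := Metric.isOpen_iff.1 hopen z hzΩ
  have hmeet : ∀ J : T.elems, z ∈ convexHull ℝ (J.1 : Set (E (n + 1))) →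
      (Metric.ball z r ∩ interior (convexHull ℝ (J.1 : Set (E (n + 1))))).Nonempty := by
    intro J hJ
    rw [← closure_interior_hull (card_elem J) (indep_elem J)] at hJ
    exact mem_closure_iff.1 hJ _ Metric.isOpen_ball (Metric.mem_ball_self hr)
  let ι := {p : T.elems × T.elems // g p.1 ≠ g p.2}
  -- Elements with different values share at most n vertices, as n + 1 would make a common face.
  -- Their intersection thus has codimension at least two, and joined with one further point a it
  -- still spans a proper subspace. Near z a generic segment from K to L therefore avoids all these
  -- intersections.
  have hcard : ∀ p : ι, (p.1.1.1 ∩ p.1.2.1).card ≤ n := by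
    rintro ⟨⟨K', L'⟩, hp⟩
    by_contra h
    push Not at h
    obtain ⟨e, he, hce⟩ := Finset.exists_subset_card_eq h
    have heK := he.trans Finset.inter_subset_left
    have heL := he.trans Finset.inter_subset_right
    exact hp (hg ⟨e, T.mem_faces.2 ⟨K'.1, K'.2, heK, hce⟩⟩ K' L' heK heL)
  obtain ⟨a, ⟨haball, haK⟩, haM⟩ := exists_mem_open_notMem_affineSubspaces
    (Metric.isOpen_ball.inter isOpen_interior) (hmeet K hzK)
    (fun p : ι => affineSpan ℝ ((p.1.1.1 ∩ p.1.2.1 : Finset (E (n + 1))) : Set (E (n + 1))))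
    (fun p => affineSpan_ne_top_of_card_le ((hcard p).trans n.le_succ))
  obtain ⟨b, ⟨hbball, hbL⟩, hbM⟩ := exists_mem_open_notMem_affineSubspaces
    (Metric.isOpen_ball.inter isOpen_interior) (hmeet L hzL)
    (fun p : ι => affineSpan ℝ ((insert a (p.1.1.1 ∩ p.1.2.1) : Finset (E (n + 1))) :
      Set (E (n + 1))))
    (fun p => affineSpan_ne_top_of_card_le
      ((Finset.card_insert_le _ _).trans (Nat.succ_le_succ (hcard p))))
  -- The segment stays in a ball inside Ω and runs from A to B, so by connectedness it must hit an
  -- intersection that a and b were chosen to avoid.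
  have hseg : segment ℝ a b ⊆ A ∪ B :=
    (((convex_ball z r).segment_subset haball hbball).trans hball).trans hAB
  obtain ⟨y, hyseg, hyA, hyB⟩ := isPreconnected_closed_iff.1
    (convex_segment a b).isPreconnected A B hA hB hseg
    ⟨a, left_mem_segment ℝ a b, mem_iUnion.2 ⟨⟨K, hK⟩, interior_subset haK⟩⟩
    ⟨b, right_mem_segment ℝ a b, mem_iUnion.2 ⟨⟨L, hL⟩, interior_subset hbL⟩⟩
  obtain ⟨⟨K', hK'⟩, hyK⟩ := mem_iUnion.1 hyA
  obtain ⟨⟨L', hL'⟩, hyL⟩ := mem_iUnion.1 hyB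
  let p : ι := ⟨(K', L'), fun h => hL' (h.symm.trans hK')⟩
  have hy : y ∈ affineSpan ℝ ((K'.1 ∩ L'.1 : Finset (E (n + 1))) : Set (E (n + 1))) := by
    apply convexHull_subset_affineSpan
    rw [Finset.coe_inter, ← T.inter_eq K'.1 K'.2 L'.1 L'.2]
    exact ⟨hyK, hyL⟩
  rw [segment_eq_image_lineMap] at hyseg
  obtain ⟨t, -, rfl⟩ := hyseg
  have ht : t ≠ 0 := by
    rintro rfl
    rw [AffineMap.lineMap_apply_zero] at hy
    exact haM p hy
  refine hbM p ?_
  have h1 : AffineMap.lineMap a b t ∈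
      affineSpan ℝ ((insert a (K'.1 ∩ L'.1) : Finset (E (n + 1))) : Set (E (n + 1))) :=
    affineSpan_mono ℝ (by exact_mod_cast Finset.subset_insert _ _) hy
  have h2 : a ∈ affineSpan ℝ ((insert a (K'.1 ∩ L'.1) : Finset (E (n + 1))) : Set (E (n + 1))) :=
    subset_affineSpan ℝ _ (by simp)
  have := AffineMap.lineMap_mem t⁻¹ h2 h1
  rwa [AffineMap.lineMap_lineMap_right, inv_mul_cancel₀ ht, AffineMap.lineMap_apply_one] at this

lemma elems_nonempty (hconn : IsConnected Ω) : Nonempty T.elems := by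
  obtain ⟨x, hx⟩ := hconn.nonempty
  have := T.union_eq.ge (subset_closure hx)
  simp only [mem_iUnion] at this
  obtain ⟨K, hK, -⟩ := this
  exact ⟨⟨K, hK⟩⟩

/-- Every mesh of a nonempty domain has a boundary face. -/
lemma exists_boundary_face (O : T.Orientation) (hconn : IsConnected Ω) :
    ∃ e : T.faces, ¬ T.IsInterior e := by
  by_contra hcon
  push Not at hcon
  -- The identity field has no jumps across interior faces; without boundary faces, its divergence n
  -- + 1 would integrate to zero over the mesh.
  have h := sum_integral_by_parts O (fun _ => AffineMap.id ℝ (E (n + 1))) (φ := fun _ => 1)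
    contDiff_const
  have h0 : ∑ e : T.faces, T.faceIntegral e (fun x => (1 : ℝ) *
      inner ℝ (O.jump e fun _ => AffineMap.id ℝ (E (n + 1)) x) (O.normal e)) = 0 := by
    refine Finset.sum_eq_zero fun e _ => ?_
    simp [Orientation.jump, hcon e, faceIntegral]
  rw [h0] at h
  have hdiv : divergence (AffineMap.id ℝ (E (n + 1))) = (n : ℝ) + 1 := by
    simp [divergence, LinearMap.trace_id]
  have hpos : 0 < ∑ K : T.elems, T.elemIntegral K
      (fun x => fderiv ℝ (fun _ : E (n + 1) => (1 : ℝ)) x (AffineMap.id ℝ (E (n + 1)) x)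
        + 1 * divergence (AffineMap.id ℝ (E (n + 1)))) := by
    have : Nonempty T.elems := elems_nonempty hconn
    refine Finset.sum_pos (fun K _ => ?_) Finset.univ_nonempty
    have := elemVol_pos K
    simp only [fderiv_fun_const, Pi.zero_apply, zero_apply, zero_add, one_mul,
      hdiv, elemIntegral_const]
    positivity
  exact hpos.ne' h

end Mesh

end Connectivity

/-! ### The velocity reconstruction -/

section Reconstruction

variable {n : ℕ} {Ω : Set (E (n + 1))}

lemma exists_affine_vertex_values {K : Finset (E (n + 1))} (hc : K.card = n + 2)
    (hi : AffineIndependent ℝ (fun x : K => (x : E (n + 1)))) (u : E (n + 1) → E (n + 1)) :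
    ∃ A : E (n + 1) →ᵃ[ℝ] E (n + 1), ∀ x ∈ K, A x = u x := by
  classical
  set B := simplexBasis hc hi
  refine ⟨∑ i : K, (LinearMap.toSpanSingleton ℝ (E (n + 1)) (u i)).toAffineMap.comp (B.coord i),
    fun x hx => ?_⟩
  have hsum : ∀ (s : Finset K) (F : K → (E (n + 1) →ᵃ[ℝ] E (n + 1))) (y : E (n + 1)),
      (∑ i ∈ s, F i) y = ∑ i ∈ s, F i y := by
    intro s F y
    induction s using Finset.induction_on with
    | empty => simp
    | insert a s ha ih =>
      rw [Finset.sum_insert ha, Finset.sum_insert ha, AffineMap.coe_add, Pi.add_apply, ih]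
  rw [hsum, Finset.sum_eq_single ⟨x, hx⟩]
  · have : B.coord ⟨x, hx⟩ x = 1 := B.coord_apply_eq ⟨x, hx⟩
    simp [this]
  · intro j _ hj
    have : B.coord j x = 0 := B.coord_apply_ne (j := ⟨x, hx⟩) hj
    simp [this]
  · simp

/-- At a vertex x the edge vectors y - x are dual to the normals of the faces through x: y - x is
orthogonal to N_z for z ≠ y, as x and y both lie opposite z, and its product with N_y is -η_y. This
makes the vertex values explicit. -/
lemma exists_affine_normal_values {K : Finset (E (n + 1))} (hc : K.card = n + 2)
    (hi : AffineIndependent ℝ (fun x : K => (x : E (n + 1)))) {N : E (n + 1) → E (n + 1)}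
    {η : E (n + 1) → ℝ} (hη : ∀ a ∈ K, 0 < η a)
    (h : ∀ a ∈ K, ∀ y ∈ K, y ≠ a → inner ℝ (N a) (y - a) = η a) (t : E (n + 1) → E (n + 1) → ℝ) :
    ∃ A : E (n + 1) →ᵃ[ℝ] E (n + 1), ∀ x ∈ K, ∀ z ∈ K, x ≠ z → inner ℝ (A x) (N z) = t z x := by
  obtain ⟨A, hA⟩ := exists_affine_vertex_values hc hi fun x => ∑ y ∈ K, (-(t y x / η y)) • (y - x)
  refine ⟨A, fun x hx z hz hxz => ?_⟩
  rw [hA x hx, sum_inner, Finset.sum_eq_single z]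
  · have h1 := h z hz x hx hxz
    rw [← neg_sub, inner_neg_right] at h1
    have h2 := (hη z hz).ne'
    rw [real_inner_smul_left, real_inner_comm]
    have : inner ℝ (N z) (z - x) = -η z := by linarith
    rw [this]
    field_simp
  · intro y hy hyz
    rw [real_inner_smul_left, real_inner_comm, ← sub_sub_sub_cancel_right y x z, inner_sub_right,
      h z hz x hx hxz, h z hz y hy hyz, sub_self, mul_zero]
  · exact fun h => absurd hz h

/-- Expanding A x about x itself removes the term of the vertex x, the one normal whose component is
not prescribed there. -/
lemma affine_eq_zero_of_normal_values {K : Finset (E (n + 1))} (hc : K.card = n + 2)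
    (hi : AffineIndependent ℝ (fun x : K => (x : E (n + 1)))) {N : E (n + 1) → E (n + 1)}
    {η : E (n + 1) → ℝ} (hη : ∀ a ∈ K, 0 < η a)
    (h : ∀ a ∈ K, ∀ y ∈ K, y ≠ a → inner ℝ (N a) (y - a) = η a) {A : E (n + 1) →ᵃ[ℝ] E (n + 1)}
    (hA : ∀ x ∈ K, ∀ z ∈ K, x ≠ z → inner ℝ (A x) (N z) = 0) : A = 0 := by
  refine AffineMap.ext_on (affineSpan_simplex hc hi) fun x hx => ?_
  rw [eq_sum_heights hc hi hη h (A x) x]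
  refine Finset.sum_eq_zero fun a ha => ?_
  by_cases hax : x = a
  · simp [hax]
  · rw [real_inner_comm, hA x hx a ha hax, zero_div, zero_smul]

/-! #### Integrals of glued functions -/

namespace Mesh

variable {T : Mesh (n + 1) Ω}

lemma integrableOn_elem (K : T.elems) {V : Type*} [NormedAddCommGroup V] {f : E (n + 1) → V}
    (hf : Continuous f) : IntegrableOn f (convexHull ℝ (K.1 : Set (E (n + 1)))) :=
  hf.continuousOn.integrableOn_compact (isCompact_hull K.1)

/-- Interiors of elements lie in Ω because Ω is the interior of its closure, and boundaries of
convex sets are null. -/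
lemma integral_glue (hΩ : interior (closure Ω) = Ω)
    {f : T.elems → E (n + 1) → ℝ} (hf : ∀ K, Continuous (f K)) :
    ∫ x in Ω, T.glue f x = ∑ K : T.elems, T.elemIntegral K (f K) := by
  unfold glue elemIntegral
  rw [integral_finsetSum]
  · refine Finset.sum_congr rfl fun K _ => ?_
    rw [integral_indicator isOpen_interior.measurableSet,
      Measure.restrict_restrict isOpen_interior.measurableSet,
      inter_eq_left.2 (interior_hull_subset hΩ K)]
    exact setIntegral_congr_set (interior_ae_eq_of_null_frontier
      ((convex_convexHull ℝ _).addHaar_frontier _))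
  · intro K _
    exact (((integrableOn_elem K (hf K)).mono_set interior_subset).integrable_indicator
      isOpen_interior.measurableSet).restrict

lemma memLp_glue {V : Type*} [NormedAddCommGroup V] [SecondCountableTopology V]
    {f : T.elems → E (n + 1) → V}
    (hf : ∀ K, Continuous (f K)) : MemLp (T.glue f) 2 (volume.restrict Ω) := by
  unfold glue
  refine memLp_finsetSum _ fun K _ => MemLp.restrict _ ?_
  rw [memLp_indicator_iff_restrict isOpen_interior.measurableSet]
  refine MemLp.mono_measure (Measure.restrict_mono_set _ interior_subset) ?_
  obtain ⟨C, hC⟩ := (isCompact_hull K.1).exists_bound_of_continuousOn (hf K).continuousOn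
  have : IsFiniteMeasure (volume.restrict (convexHull ℝ (K.1 : Set (E (n + 1))))) :=
    ⟨by simpa using (isCompact_hull K.1).measure_lt_top⟩
  exact MemLp.of_bound (hf K).aestronglyMeasurable C
    (ae_restrict_of_forall_mem (measurableSet_hull K.1) hC)

lemma map_glue {V W : Type*} [AddCommGroup V] [AddCommGroup W] (f : T.elems → E (n + 1) → V)
    (ℓ : E (n + 1) → V →+ W) (x : E (n + 1)) :
    ℓ x (T.glue f x) = T.glue (fun K y => ℓ y (f K y)) x := by
  classical
  unfold glue
  rw [map_sum]
  refine Finset.sum_congr rfl fun K _ => ?_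
  by_cases hx : x ∈ interior (convexHull ℝ (K.1 : Set (E (n + 1))))
  · rw [indicator_of_mem hx, indicator_of_mem hx]
  · rw [indicator_of_notMem hx, indicator_of_notMem hx, map_zero]

lemma elemIntegral_add (K : T.elems) {f g : E (n + 1) → ℝ} (hf : Continuous f)
    (hg : Continuous g) :
    T.elemIntegral K (fun x => f x + g x) = T.elemIntegral K f + T.elemIntegral K g :=
  integral_add (integrableOn_elem K hf) (integrableOn_elem K hg)

/-- Piecewise affine fields with continuous normal component, vanishing on the boundary, are in
`H(div)`. -/
lemma mem_BDM1_of_jump (hΩ : interior (closure Ω) = Ω) (O : T.Orientation)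
    {w : T.VecP1} (hw : ∀ (e : T.faces), ∀ x ∈ convexHull ℝ (e.1 : Set (E (n + 1))),
      inner ℝ (O.jump e fun K => w K x) (O.normal e) = 0) : w ∈ T.BDM1 := by
  have hwc := fun K => continuous_affine (w K)
  refine ⟨memLp_glue hwc, T.scalFun fun K => divergence (w K),
    memLp_glue fun K => continuous_const, fun φ hφ => ?_⟩
  have hφ1 : ContDiff ℝ 1 φ := hφ.1.of_le (by exact_mod_cast le_top)
  have hφc := hφ1.continuous
  have hφd := hφ1.continuous_fderiv one_ne_zero
  have h1 : ∀ x, fderiv ℝ φ x (T.vecFun w x) = T.glue (fun K y => fderiv ℝ φ y (w K y)) x :=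
    map_glue _ fun x => (fderiv ℝ φ x : E (n + 1) →+ ℝ)
  have h2 : ∀ x, T.scalFun (fun K => divergence (w K)) x * φ x
      = T.glue (fun K y => φ y * divergence (w K)) x := fun x => by
    rw [mul_comm]
    exact map_glue _ (fun x => AddMonoidHom.mulLeft (φ x)) x
  simp only [h1, h2]
  rw [integral_glue hΩ (fun K => by have := hwc K; fun_prop),
    integral_glue hΩ (fun K => by fun_prop), eq_neg_iff_add_eq_zero,
    ← Finset.sum_add_distrib]
  have h3 := sum_integral_by_parts O w hφ1
  have h4 : ∀ K : T.elems,
      T.elemIntegral K (fun x => fderiv ℝ φ x (w K x)) + T.elemIntegral K (fun x => φ x * divergence (w K))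
        = T.elemIntegral K (fun x => fderiv ℝ φ x (w K x) + φ x * divergence (w K)) := fun K =>
    (elemIntegral_add K (hφd.clm_apply (hwc K)) (by fun_prop)).symm
  rw [Finset.sum_congr rfl fun K _ => h4 K, h3]
  refine Finset.sum_eq_zero fun e _ => ?_
  rw [faceIntegral_congr (g := fun _ => 0) fun x hx => by rw [hw e x hx, mul_zero]]
  simp [faceIntegral]

/-! ### Normal degrees of freedom and the reconstruction. -/

namespace Orientation

variable (O : T.Orientation)

lemma exists_vertex_normals (K : T.elems) : ∃ (N : E (n + 1) → E (n + 1)) (η : E (n + 1) → ℝ),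
    (∀ a ∈ K.1, 0 < η a) ∧ (∀ a ∈ K.1, ∀ y ∈ K.1, y ≠ a → inner ℝ (N a) (y - a) = η a) ∧
    (∀ a ∈ K.1, ∃ e : T.faces, e.1 ⊆ K.1 ∧ (∀ x, x ∈ e.1 ↔ x ∈ K.1 ∧ x ≠ a) ∧
      N a = O.outNormal K e) := by
  classical
  have hface : ∀ a ∈ K.1, K.1.erase a ∈ T.faces := fun a ha =>
    T.mem_faces.2 ⟨K.1, K.2, Finset.erase_subset _ _, by
      rw [Finset.card_erase_of_mem ha, card_elem]; rfl⟩
  have hex : ∀ a, ∃ (N : E (n + 1)) (η : ℝ), a ∈ K.1 → 0 < η ∧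
      (∀ y ∈ K.1, y ≠ a → inner ℝ N (y - a) = η) ∧
      ∃ e : T.faces, e.1 ⊆ K.1 ∧ (∀ x, x ∈ e.1 ↔ x ∈ K.1 ∧ x ≠ a) ∧ N = O.outNormal K e := by
    intro a
    by_cases ha : a ∈ K.1
    · let e : T.faces := ⟨K.1.erase a, hface a ha⟩
      have heK : e.1 ⊆ K.1 := Finset.erase_subset _ _
      obtain ⟨η, hη, h⟩ := (O.isOutwardNormal_outNormal heK).exists_height (face_nonempty e) ha
        (Finset.notMem_erase a K.1)
      exact ⟨O.outNormal K e, η, fun _ => ⟨hη, fun y hy hya => h y (Finset.mem_erase.2 ⟨hya, hy⟩),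
        e, heK, fun x => by simp [e, and_comm], rfl⟩⟩
    · exact ⟨0, 0, fun h => absurd h ha⟩
  choose N η h using hex
  exact ⟨N, η, fun a ha => (h a ha).1, fun a ha => (h a ha).2.1, fun a ha => (h a ha).2.2⟩

lemma face_eq_of_mem_iff {K : T.elems} {e e' : T.faces} (he : e.1 ⊆ K.1) {a : E (n + 1)}
    (hae : a ∉ e.1) (he' : ∀ x, x ∈ e'.1 ↔ x ∈ K.1 ∧ x ≠ a) : e' = e := by
  refine Subtype.ext (Finset.eq_of_subset_of_card_le ?_ ?_).symm
  · intro x hx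
    exact (he' x).2 ⟨he hx, fun h => hae (h ▸ hx)⟩
  · rw [card_face, card_face]

lemma inner_outNormal (K : T.elems) (e : T.faces) (v : E (n + 1)) :
    inner ℝ v (O.outNormal K e) = inner ℝ v (O.normal e) ∨
      inner ℝ v (O.outNormal K e) = -inner ℝ v (O.normal e) := by
  unfold outNormal
  split_ifs
  · exact Or.inl rfl
  · right; rw [inner_neg_right]

lemma inner_outNormal_eq_zero {K : T.elems} {e : T.faces} {v : E (n + 1)} :
    inner ℝ v (O.outNormal K e) = 0 ↔ inner ℝ v (O.normal e) = 0 := by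
  rcases O.inner_outNormal K e v with h | h <;> simp [h]

/-- A local field is determined by its normal components at the vertices. -/
lemma affine_eq_zero {K : T.elems} {A : E (n + 1) →ᵃ[ℝ] E (n + 1)}
    (hA : ∀ e : T.faces, e.1 ⊆ K.1 → ∀ x ∈ e.1, inner ℝ (A x) (O.normal e) = 0) : A = 0 := by
  obtain ⟨N, η, hη, h, hN⟩ := O.exists_vertex_normals K
  refine affine_eq_zero_of_normal_values (card_elem K) (indep_elem K) hη h fun x hx z hz hxz => ?_
  obtain ⟨e, heK, hmem, hNe⟩ := hN z hz
  rw [hNe, O.inner_outNormal_eq_zero]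
  exact hA e heK x ((hmem x).2 ⟨hx, hxz⟩)

/-- A local field with prescribed normal components at the vertices. -/
lemma exists_affine (K : T.elems) (τ : T.faces → E (n + 1) → ℝ) :
    ∃ A : E (n + 1) →ᵃ[ℝ] E (n + 1), ∀ e : T.faces, e.1 ⊆ K.1 → ∀ x ∈ e.1,
      inner ℝ (A x) (O.normal e) = τ e x := by
  classical
  obtain ⟨N, η, hη, h, hN⟩ := O.exists_vertex_normals K
  have hex : ∀ z, ∃ e : T.faces, z ∈ K.1 → e.1 ⊆ K.1 ∧ (∀ x, x ∈ e.1 ↔ x ∈ K.1 ∧ x ≠ z) ∧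
      N z = O.outNormal K e := by
    obtain ⟨y, hy⟩ : K.1.Nonempty := by rw [← Finset.card_pos, card_elem]; omega
    obtain ⟨e₀, -⟩ := hN y hy
    intro z
    by_cases hz : z ∈ K.1
    · obtain ⟨e, he⟩ := hN z hz
      exact ⟨e, fun _ => he⟩
    · exact ⟨e₀, fun h => absurd h hz⟩
  choose f hf using hex
  -- The normal n_e points outward only from `plus`; seen from the other element, the prescribed
  -- value changes sign.
  obtain ⟨A, hA⟩ := exists_affine_normal_values (card_elem K) (indep_elem K) hη h
    fun z x => (if K = O.plus (f z) then 1 else -1) * τ (f z) x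
  refine ⟨A, fun e heK x hx => ?_⟩
  obtain ⟨z, hz, hze, -⟩ := exists_opposite (card_elem K) heK (card_face e)
  obtain ⟨-, hmem, hNz⟩ := hf z hz
  have hfe : f z = e := face_eq_of_mem_iff heK hze hmem
  have := hA x (heK hx) z hz (fun h => hze (h ▸ hx))
  rw [hNz, hfe, outNormal] at this
  split_ifs at this
  · linarith
  · rw [inner_neg_right] at this
    linarith

lemma avg_apply (e : T.faces) (v : T.VecP1) (x : E (n + 1)) :
    O.avg e v x = O.avg e fun K => v K x := by
  unfold avg
  split_ifs <;> rfl

/-- The scalar affine function `⟨A x, N⟩`. -/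
noncomputable def normalPart (A : E (n + 1) →ᵃ[ℝ] E (n + 1)) (N : E (n + 1)) :
    E (n + 1) →ᵃ[ℝ] ℝ :=
  (innerSL ℝ N).toLinearMap.toAffineMap.comp A

lemma normalPart_apply (A : E (n + 1) →ᵃ[ℝ] E (n + 1)) (N x : E (n + 1)) :
    normalPart A N x = inner ℝ (A x) N := by
  simp [normalPart, real_inner_comm]

/-- `w` has the normal moments of the reconstruction of `v`. -/
def HasNormalMoments (v w : T.VecP1) : Prop :=
  (∀ e : T.faces, T.IsInterior e → ∀ K : T.elems, e.1 ⊆ K.1 → ∀ p : E (n + 1) →ᵃ[ℝ] ℝ,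
    T.faceIntegral e (fun x => inner ℝ (w K x) (O.normal e) * p x)
      = T.faceIntegral e (fun x => inner ℝ (O.avg e fun L => v L x) (O.normal e) * p x)) ∧
  (∀ e : T.faces, ¬ T.IsInterior e → ∀ K : T.elems, e.1 ⊆ K.1 → ∀ p : E (n + 1) →ᵃ[ℝ] ℝ,
    T.faceIntegral e (fun x => inner ℝ (w K x) (O.normal e) * p x) = 0)

/-- On each face the normal component of the difference is itself an admissible p, so its square
integrates to zero and it vanishes there. Doing so on all faces of an element kills the difference.
-/
lemma normalMoments_unique {v w w' : T.VecP1} (h : O.HasNormalMoments v w)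
    (h' : O.HasNormalMoments v w') : w = w' := by
  funext K
  rw [← sub_eq_zero]
  refine O.affine_eq_zero (K := K) fun e heK x hx => ?_
  set g := normalPart (w K - w' K) (O.normal e) with hg
  have heq : T.faceIntegral e (fun x => inner ℝ (w K x) (O.normal e) * g x)
      = T.faceIntegral e (fun x => inner ℝ (w' K x) (O.normal e) * g x) := by
    by_cases hint : T.IsInterior e
    · rw [h.1 e hint K heK g, h'.1 e hint K heK g]
    · rw [h.2 e hint K heK g, h'.2 e hint K heK g]
  have hw := continuous_affine (w K)
  have hw' := continuous_affine (w' K)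
  have hgc := continuous_affine g
  have hzero : T.faceIntegral e (fun x => g x * g x) = 0 := by
    have : (fun x => g x * g x) = fun x => inner ℝ (w K x) (O.normal e) * g x
        + (-1) * (inner ℝ (w' K x) (O.normal e) * g x) := by
      funext x
      nth_rewrite 1 [hg]
      rw [normalPart_apply, AffineMap.coe_sub, Pi.sub_apply, inner_sub_left]
      ring
    rw [this, faceIntegral_add O e (by fun_prop) (by fun_prop), faceIntegral_const_mul, heq]
    ring
  obtain ⟨a, ha, hae, hK, η, hη, hh⟩ := exists_height heK (O.isOutwardNormal_outNormal heK)
  have := affine_eq_zero_of_integral_sq (face_nonempty e) (O.isOutwardNormal_outNormal heK).1 hη hh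
    hK (card_elem K) (indep_elem K) g hzero x hx
  rwa [hg, normalPart_apply] at this

/-- Since {v}·n_e is affine, the moment conditions can be met pointwise by prescribing its vertex
values, and zero on boundary faces. Both neighbours then have the same normal component, which gives
H(div). -/
lemma exists_reconstruction (hΩ : interior (closure Ω) = Ω) (v : T.VecP1) :
    ∃ w, O.IsReconstruction v w := by
  classical
  set τ : T.faces → (E (n + 1) →ᵃ[ℝ] ℝ) := fun e =>
    if T.IsInterior e then normalPart (O.avg e v) (O.normal e) else 0 with hτ
  choose w hw using fun K => O.exists_affine K fun e x => τ e x
  have hτe : ∀ (K : T.elems) (e : T.faces), e.1 ⊆ K.1 → ∀ x ∈ convexHull ℝ (e.1 : Set (E (n + 1))),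
      inner ℝ (w K x) (O.normal e) = τ e x := by
    intro K e heK x hx
    rw [← normalPart_apply]
    refine affineMap_eqOn_hull (fun y hy => ?_) x hx
    rw [normalPart_apply]
    exact hw K e heK y hy
  refine ⟨w, mem_BDM1_of_jump hΩ O fun e x hx => ?_, fun e hint K heK p => ?_,
    fun e hint K heK p => ?_⟩
  · unfold jump
    split_ifs with hint
    · rw [inner_sub_left, hτe _ e (O.subset_plus e) x hx, hτe _ e (O.subset_minus e) x hx, sub_self]
    · rw [hτe _ e (O.subset_plus e) x hx]
      simp [hτ, hint]
  · refine faceIntegral_congr fun x hx => ?_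
    simp only [hτe K e heK x hx, hτ, if_pos hint, normalPart_apply, avg_apply]
  · rw [faceIntegral_congr (g := fun _ => 0) fun x hx => by
      simp [hτe K e heK x hx, hτ, if_neg hint]]
    simp [faceIntegral]

end Orientation

end Mesh

end Reconstruction

/-! ### Coercivity -/

section Coercivity

variable {n : ℕ} {Ω : Set (E (n + 1))}

lemma frob_self (L : E (n + 1) →ₗ[ℝ] E (n + 1)) :
    Mesh.frob L L = ∑ i, ‖L (EuclideanSpace.single i 1)‖ ^ 2 := by
  simp [Mesh.frob]

lemma frob_self_nonneg (L : E (n + 1) →ₗ[ℝ] E (n + 1)) : 0 ≤ Mesh.frob L L := by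
  rw [frob_self]; positivity

lemma norm_apply_sq_le_frob (L : E (n + 1) →ₗ[ℝ] E (n + 1)) (x : E (n + 1)) :
    ‖L x‖ ^ 2 ≤ Mesh.frob L L * ‖x‖ ^ 2 := by
  have hx : L x = ∑ i, x i • L (EuclideanSpace.single i 1) := by
    have h := (EuclideanSpace.basisFun (Fin (n + 1)) ℝ).sum_repr x
    simp only [EuclideanSpace.basisFun_repr, EuclideanSpace.basisFun_apply] at h
    nth_rewrite 1 [← h]
    simp only [map_sum, map_smul]
  have h1 : ‖L x‖ ≤ ∑ i, ‖x i‖ * ‖L (EuclideanSpace.single i 1)‖ := by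
    rw [hx]
    exact (norm_sum_le _ _).trans (Finset.sum_le_sum fun i _ => (norm_smul _ _).le)
  calc ‖L x‖ ^ 2 ≤ (∑ i, ‖x i‖ * ‖L (EuclideanSpace.single i 1)‖) ^ 2 := by gcongr
    _ ≤ (∑ i, ‖x i‖ ^ 2) * ∑ i, ‖L (EuclideanSpace.single i 1)‖ ^ 2 :=
      Finset.sum_mul_sq_le_sq_mul_sq _ _ _
    _ = Mesh.frob L L * ‖x‖ ^ 2 := by rw [frob_self, EuclideanSpace.norm_sq_eq, mul_comm]

lemma eq_zero_of_frob_self {L : E (n + 1) →ₗ[ℝ] E (n + 1)} (h : Mesh.frob L L = 0) : L = 0 := by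
  ext1 x
  have := norm_apply_sq_le_frob L x
  rw [h, zero_mul] at this
  simpa using le_antisymm this (sq_nonneg _)

lemma inner_mem_Icc_of_mem_hull {e : Finset (E (n + 1))} (he : e.Nonempty) {N a : E (n + 1)}
    {η : ℝ} (hη : 0 < η) (h : ∀ y ∈ e, inner ℝ N (y - a) = η) {x : E (n + 1)}
    (hx : x ∈ convexHull ℝ (insert a (e : Set (E (n + 1))))) : inner ℝ N (x - a) ∈ Icc 0 η := by
  rw [hull_insert_eq_cone (by simpa using he)] at hx
  obtain ⟨⟨s, y⟩, ⟨⟨h0, h1⟩, hy⟩, rfl⟩ := hx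
  simp only [add_sub_cancel_left, inner_smul_right, inner_hull_eq h y hy]
  exact ⟨mul_nonneg h0 hη.le, mul_le_of_le_one_left hη.le h1⟩

namespace Mesh

/-! ### The discrete trace estimate. -/

variable {T : Mesh (n + 1) Ω}

/-- The constant in the discrete trace estimate `h_e |e| ≤ C |K|`. -/
noncomputable def traceConst (n : ℕ) (σ : ℝ) : ℝ :=
  (((n : ℝ) + 1) * volume.real (Metric.ball (0 : E (n + 1)) 1) * |σ|) ^ (1 / (n : ℝ)) * |σ|
    * ((n : ℝ) + 1)

lemma traceConst_nonneg (n : ℕ) (σ : ℝ) : 0 ≤ traceConst n σ := by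
  unfold traceConst
  positivity

lemma faceSize_eq (e : T.faces) : T.faceSize e = T.faceArea e ^ (1 / (n : ℝ)) := by
  unfold faceSize faceArea
  congr 2
  push_cast
  ring

lemma faceSize_pos (O : T.Orientation) (e : T.faces) : 0 < T.faceSize e := by
  rw [faceSize_eq]
  exact Real.rpow_pos_of_pos (faceArea_pos O e) _

/-- With D the diameter and η the height over e, the inscribed ball gives r ≤ η, so D ≤ σ η.
Inserting |K| ≤ β D ^ (n + 1) into (n + 1)|K| = η |e| bounds |e| by a multiple of D ^ n. Hence h_e
is at most a multiple of D, thus of η, and η |e| is again (n + 1)|K|. -/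
lemma faceSize_mul_faceArea_le (hn : n ≠ 0) {σ : ℝ} (hσ : T.IsShapeRegular σ) (O : T.Orientation)
    {K : T.elems} {e : T.faces} (heK : e.1 ⊆ K.1) :
    T.faceSize e * T.faceArea e ≤ traceConst n σ * T.elemVol K := by
  obtain ⟨c, r, hr, hball, hdiam⟩ := hσ K.1 K.2
  have hN := O.isOutwardNormal_outNormal heK
  obtain ⟨a, ha, hae, hK, η, hη, h⟩ := exists_height heK hN
  set N := O.outNormal K e
  set D := Metric.diam (convexHull ℝ (K.1 : Set (E (n + 1)))) with hD
  set β := volume.real (Metric.ball (0 : E (n + 1)) 1) with hβ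
  have hD0 : 0 ≤ D := Metric.diam_nonneg
  have hσ0 : 0 ≤ σ := by
    by_contra hneg
    push Not at hneg
    have := mul_neg_of_neg_of_pos hneg hr
    linarith
  have hβ0 : 0 ≤ β := measureReal_nonneg
  -- The centre c and the point c + r N of the ball both have height between 0 and η above the
  -- opposite vertex, and these heights differ by r.
  have hrη : r ≤ η := by
    have hNN : inner ℝ N N = 1 := by rw [real_inner_self_eq_norm_sq, hN.1]; norm_num
    have h1 : c + r • N ∈ convexHull ℝ (insert a (e.1 : Set (E (n + 1)))) := by
      rw [← hK]
      exact hball (by simp [norm_smul, hN.1, abs_of_pos hr])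
    have h2 : c ∈ convexHull ℝ (insert a (e.1 : Set (E (n + 1)))) := by
      rw [← hK]
      exact hball (Metric.mem_closedBall_self hr.le)
    have h3 := (inner_mem_Icc_of_mem_hull (face_nonempty e) hη h h1).2
    have h4 := (inner_mem_Icc_of_mem_hull (face_nonempty e) hη h h2).1
    rw [add_sub_right_comm, inner_add_right, inner_smul_right, hNN] at h3
    linarith
  have hvol := elemVol_eq hN.1 hK hη h
  have hV : T.elemVol K ≤ D ^ (n + 1) * β := by
    have hsub : convexHull ℝ (K.1 : Set (E (n + 1))) ⊆ Metric.closedBall a D := fun x hx =>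
      Metric.dist_le_diam_of_mem (isCompact_hull K.1).isBounded hx (subset_convexHull ℝ _ ha)
    have h1 : T.elemVol K ≤ volume.real (Metric.closedBall a D) :=
      measureReal_mono hsub (isCompact_closedBall a D).measure_lt_top.ne
    refine h1.trans (le_of_eq ?_)
    rw [measureReal_def, Measure.addHaar_closedBall _ _ hD0, ENNReal.toReal_mul,
      ENNReal.toReal_ofReal (by positivity)]
    simp [hβ, measureReal_def]
  have hA0 := faceArea_pos O e
  have hA : T.faceArea e ≤ ((n : ℝ) + 1) * β * σ * D ^ n := by
    have h1 : η * T.faceArea e ≤ η * (((n : ℝ) + 1) * β * σ * D ^ n) := by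
      calc η * T.faceArea e = ((n : ℝ) + 1) * T.elemVol K := hvol.symm
        _ ≤ ((n : ℝ) + 1) * (D ^ (n + 1) * β) := by gcongr
        _ = ((n : ℝ) + 1) * β * D ^ n * D := by ring
        _ ≤ ((n : ℝ) + 1) * β * D ^ n * (σ * r) := by gcongr
        _ ≤ ((n : ℝ) + 1) * β * D ^ n * (σ * η) := by gcongr
        _ = η * (((n : ℝ) + 1) * β * σ * D ^ n) := by ring
    exact le_of_mul_le_mul_left h1 hη
  set κ := (((n : ℝ) + 1) * β * σ) ^ (1 / (n : ℝ)) with hκ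
  have hκ0 : 0 ≤ κ := by positivity
  have hs : T.faceSize e ≤ κ * σ * η := by
    calc T.faceSize e = T.faceArea e ^ (1 / (n : ℝ)) := faceSize_eq e
      _ ≤ (((n : ℝ) + 1) * β * σ * D ^ n) ^ (1 / (n : ℝ)) := by gcongr
      _ = κ * D := by
        rw [Real.mul_rpow (by positivity) (by positivity), one_div,
          Real.pow_rpow_inv_natCast hD0 hn, hκ, one_div]
      _ ≤ κ * (σ * r) := by gcongr
      _ ≤ κ * (σ * η) := by gcongr
      _ = κ * σ * η := by ring
  calc T.faceSize e * T.faceArea e ≤ κ * σ * η * T.faceArea e := by gcongr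
    _ = κ * σ * (((n : ℝ) + 1) * T.elemVol K) := by rw [hvol]; ring
    _ = traceConst n σ * T.elemVol K := by
      rw [traceConst, abs_of_nonneg hσ0]; ring

lemma faceIntegral_mono (O : T.Orientation) {e : T.faces} {f g : E (n + 1) → ℝ}
    (hf : Continuous f) (hg : Continuous g) (h : ∀ x, f x ≤ g x) :
    T.faceIntegral e f ≤ T.faceIntegral e g :=
  integral_mono (integrableOn_face O e hf) (integrableOn_face O e hg) h

lemma faceIntegral_nonneg {e : T.faces} {f : E (n + 1) → ℝ} (h : ∀ x, 0 ≤ f x) :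
    0 ≤ T.faceIntegral e f :=
  integral_nonneg h

namespace Orientation

variable (O : T.Orientation)

/-- The broken Dirichlet energy. -/
noncomputable def gradEnergy (T : Mesh (n + 1) Ω) (v : T.VecP1) : ℝ :=
  ∑ K : T.elems, T.elemVol K * frob (v K).linear (v K).linear

/-- The energy of the jumps on the face `e`. -/
noncomputable def jumpEnergy (v : T.VecP1) (e : T.faces) : ℝ :=
  T.faceIntegral e fun x =>
    (T.faceSize e)⁻¹ * inner ℝ (O.jump e fun K => v K x) (O.jump e fun K => v K x)

lemma gradEnergy_nonneg (v : T.VecP1) : 0 ≤ gradEnergy T v :=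
  Finset.sum_nonneg fun K _ => mul_nonneg (elemVol_pos K).le (frob_self_nonneg _)

lemma jumpEnergy_nonneg (v : T.VecP1) (e : T.faces) : 0 ≤ O.jumpEnergy v e :=
  faceIntegral_nonneg fun _ =>
    mul_nonneg (inv_nonneg.2 (faceSize_pos O e).le) real_inner_self_nonneg

lemma a_self (ν ρ : ℝ) (v : T.VecP1) :
    O.a ν ρ v v = ν * (gradEnergy T v - 2 * O.consistency v v + ρ * ∑ e, O.jumpEnergy v e) := by
  unfold a gradEnergy jumpEnergy
  simp only [elemIntegral_const]
  ring

lemma norm_avg_sq_le (e : T.faces) (y : T.elems → E (n + 1)) [Decidable (T.IsInterior e)] :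
    ‖O.avg e y‖ ^ 2 ≤ ‖y (O.plus e)‖ ^ 2 + if T.IsInterior e then ‖y (O.minus e)‖ ^ 2 else 0 := by
  unfold avg
  by_cases h : T.IsInterior e
  · simp only [if_pos h]
    have h1 : ‖(1 / 2 : ℝ) • (y (O.plus e) + y (O.minus e))‖
        ≤ 1 / 2 * (‖y (O.plus e)‖ + ‖y (O.minus e)‖) := by
      rw [norm_smul]
      norm_num
      exact norm_add_le _ _
    nlinarith [norm_nonneg ((1 / 2 : ℝ) • (y (O.plus e) + y (O.minus e))),
      norm_nonneg (y (O.plus e)), norm_nonneg (y (O.minus e)),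
      sq_nonneg (‖y (O.plus e)‖ - ‖y (O.minus e)‖)]
  · simp [h]

/-- Young's inequality on each face with weight ε h_e on the averaged gradient; the resulting h_e
|e| is what the trace estimate absorbs. The factor n + 2 counts the faces of a simplex, each charged
to the energy of the element. -/
lemma two_consistency_le (hn : n ≠ 0) {σ : ℝ} (hσ : T.IsShapeRegular σ) (v : T.VecP1) {ε : ℝ}
    (hε : 0 < ε) :
    2 * O.consistency v v
      ≤ ε * (((n : ℝ) + 2) * traceConst n σ) * gradEnergy T v + ε⁻¹ * ∑ e, O.jumpEnergy v e := by
  classical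
  set X : T.elems → ℝ := fun K => traceConst n σ * (T.elemVol K * frob (v K).linear (v K).linear)
    with hX
  have hface : ∀ e : T.faces, 2 * T.faceIntegral e (fun x =>
      inner ℝ (O.avg e fun K => (v K).linear (O.normal e)) (O.jump e fun K => v K x))
      ≤ ε * (X (O.plus e) + if T.IsInterior e then X (O.minus e) else 0)
        + ε⁻¹ * O.jumpEnergy v e := by
    intro e
    set g := O.avg e fun K => (v K).linear (O.normal e) with hg
    have hh := faceSize_pos O e
    have hjc := continuous_jump O v e
    have h1 : 2 * T.faceIntegral e (fun x => inner ℝ g (O.jump e fun K => v K x))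
        ≤ T.faceArea e * (ε * T.faceSize e * ‖g‖ ^ 2) + ε⁻¹ * O.jumpEnergy v e := by
      rw [← faceIntegral_const_mul, ← faceIntegral_const, jumpEnergy, ← faceIntegral_const_mul,
        ← faceIntegral_add O e continuous_const (by fun_prop)]
      refine faceIntegral_mono O (by fun_prop) (by fun_prop) fun x => ?_
      set j := O.jump e fun K => v K x
      have h2 : inner ℝ g j ≤ ‖g‖ * ‖j‖ := real_inner_le_norm g j
      rw [real_inner_self_eq_norm_sq]
      have h3 : ε * T.faceSize e * ‖g‖ ^ 2 + ε⁻¹ * ((T.faceSize e)⁻¹ * ‖j‖ ^ 2)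
          - 2 * (‖g‖ * ‖j‖) = (ε * T.faceSize e) * (‖g‖ - (ε * T.faceSize e)⁻¹ * ‖j‖) ^ 2 := by
        field_simp
        ring
      have h4 : 0 ≤ (ε * T.faceSize e) * (‖g‖ - (ε * T.faceSize e)⁻¹ * ‖j‖) ^ 2 := by positivity
      linarith
    have h5 : ∀ K : T.elems, e.1 ⊆ K.1 →
        T.faceSize e * T.faceArea e * ‖(v K).linear (O.normal e)‖ ^ 2 ≤ X K := by
      intro K heK
      have h6 := norm_apply_sq_le_frob (v K).linear (O.normal e)
      rw [(O.outward e).1, one_pow, mul_one] at h6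
      have h7 := faceSize_mul_faceArea_le hn hσ O heK
      have h8 := traceConst_nonneg n σ
      have h9 := elemVol_pos K
      calc _ ≤ (traceConst n σ * T.elemVol K) * frob (v K).linear (v K).linear := by gcongr
        _ = X K := by rw [hX]; ring
    have h10 : T.faceSize e * T.faceArea e * ‖g‖ ^ 2
        ≤ X (O.plus e) + if T.IsInterior e then X (O.minus e) else 0 := by
      have hp : 0 ≤ T.faceSize e * T.faceArea e := mul_nonneg hh.le (faceArea_pos O e).le
      refine (mul_le_mul_of_nonneg_left (O.norm_avg_sq_le e _) hp).trans ?_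
      rw [mul_add]
      refine add_le_add (h5 _ (O.subset_plus e)) ?_
      split_ifs
      · exact h5 _ (O.subset_minus e)
      · simp
    have h11 := mul_le_mul_of_nonneg_left h10 hε.le
    linarith
  unfold consistency
  rw [Finset.mul_sum]
  refine (Finset.sum_le_sum fun e _ => hface e).trans (le_of_eq ?_)
  rw [Finset.sum_add_distrib, ← Finset.mul_sum, ← Finset.mul_sum,
    ← O.sum_elems_faces fun K _ => X K]
  simp only [Finset.sum_const, card_faces_of_elem, nsmul_eq_mul]
  rw [← Finset.mul_sum, hX, ← Finset.mul_sum]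
  unfold gradEnergy
  push_cast
  ring

/-- The threshold for the penalty parameter. -/
noncomputable def penaltyThreshold (n : ℕ) (σ : ℝ) : ℝ :=
  2 * (((n : ℝ) + 2) * traceConst n σ + 1) + 1

lemma penaltyThreshold_pos (n : ℕ) (σ : ℝ) : 0 < penaltyThreshold n σ := by
  have := traceConst_nonneg n σ
  unfold penaltyThreshold
  positivity

/-- The choice ε = 1 / (2(C + 1)) costs at most half of the gradient energy; the + 1 keeps it
meaningful when C = 0. The penalty must then beat ε⁻¹ = 2(C + 1), and the extra 1 in the threshold
leaves the jump energy with coefficient one. -/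
lemma a_self_ge (hn : n ≠ 0) {σ : ℝ} (hσ : T.IsShapeRegular σ) {ν ρ : ℝ} (hν : 0 < ν)
    (hρ : penaltyThreshold n σ ≤ ρ) (v : T.VecP1) :
    ν * (1 / 2 * gradEnergy T v + ∑ e, O.jumpEnergy v e) ≤ O.a ν ρ v v := by
  rw [a_self]
  refine mul_le_mul_of_nonneg_left ?_ hν.le
  set C := ((n : ℝ) + 2) * traceConst n σ with hC
  have hC0 : 0 ≤ C := mul_nonneg (by positivity) (traceConst_nonneg n σ)
  have hε : 0 < (2 * (C + 1))⁻¹ := by positivity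
  have h1 := O.two_consistency_le hn hσ v hε
  rw [← hC, inv_inv] at h1
  have hG := gradEnergy_nonneg v
  have hJ : 0 ≤ ∑ e, O.jumpEnergy v e := Finset.sum_nonneg fun e _ => O.jumpEnergy_nonneg v e
  have h2 : (2 * (C + 1))⁻¹ * C ≤ 1 / 2 := by
    rw [inv_mul_le_iff₀ (by positivity)]
    linarith
  have h3 := mul_le_mul_of_nonneg_right h2 hG
  have h4 : (2 * (C + 1) + 1) * ∑ e, O.jumpEnergy v e ≤ ρ * ∑ e, O.jumpEnergy v e :=
    mul_le_mul_of_nonneg_right hρ hJ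
  linarith

/-- The form `a` is positive definite on all piecewise affine fields. -/
theorem eq_zero_of_a_self (hn : n ≠ 0) (hopen : IsOpen Ω) (hconn : IsConnected Ω)
    (hΩ : interior (closure Ω) = Ω) {σ : ℝ} (hσ : T.IsShapeRegular σ) {ν ρ : ℝ} (hν : 0 < ν)
    (hρ : penaltyThreshold n σ ≤ ρ) {v : T.VecP1} (hv : O.a ν ρ v v = 0) : v = 0 := by
  have h1 := O.a_self_ge hn hσ hν hρ v
  rw [hv] at h1
  have hG := gradEnergy_nonneg v
  have hJ : 0 ≤ ∑ e, O.jumpEnergy v e := Finset.sum_nonneg fun e _ => O.jumpEnergy_nonneg v e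
  have h2 : 1 / 2 * gradEnergy T v + ∑ e, O.jumpEnergy v e ≤ 0 := by
    by_contra h
    push Not at h
    have := mul_pos hν h
    linarith
  have hG0 : gradEnergy T v = 0 := by linarith
  have hJ0 : ∑ e, O.jumpEnergy v e = 0 := by linarith
  have hlin : ∀ K, (v K).linear = 0 := by
    intro K
    have := (Finset.sum_eq_zero_iff_of_nonneg fun K _ =>
      mul_nonneg (elemVol_pos K).le (frob_self_nonneg (v K).linear)).1 hG0 K (Finset.mem_univ K)
    rcases mul_eq_zero.1 this with h | h
    · exact absurd h (elemVol_pos K).ne'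
    · exact eq_zero_of_frob_self h
  have hconst : ∀ K x, v K x = v K 0 := by
    intro K x
    have := congrFun (AffineMap.decomp (v K)) x
    simpa [hlin K] using this
  have hjump : ∀ e, (O.jump e fun K => v K 0) = 0 := by
    intro e
    have := (Finset.sum_eq_zero_iff_of_nonneg fun e _ => O.jumpEnergy_nonneg v e).1 hJ0 e
      (Finset.mem_univ e)
    unfold jumpEnergy at this
    simp only [hconst, faceIntegral_const] at this
    rcases mul_eq_zero.1 this with h | h
    · exact absurd h (faceArea_pos O e).ne'
    · rcases mul_eq_zero.1 h with h | h
      · exact absurd h (inv_pos.2 (faceSize_pos O e)).ne'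
      · exact inner_self_eq_zero.1 h
  have hall : ∀ K L : T.elems, v K 0 = v L 0 := by
    refine eq_of_face_neighbors hopen hconn hΩ fun e K L heK heL => ?_
    by_cases hint : T.IsInterior e
    · have h := hjump e
      simp only [jump, if_pos hint, sub_eq_zero] at h
      rcases O.eq_plus_or_minus hint heK with rfl | rfl <;>
      rcases O.eq_plus_or_minus hint heL with rfl | rfl <;> simp [h]
    · rw [O.eq_plus hint heK, O.eq_plus hint heL]
  obtain ⟨e, he⟩ := exists_boundary_face O hconn
  have h0 := hjump e
  simp only [jump, if_neg he] at h0
  funext K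
  ext1 x
  rw [hconst K x, hall K (O.plus e), h0]
  rfl

/-! ### Uniqueness of the pressure -/

lemma centroid_eq (K : T.elems) :
    K.1.centroid ℝ id = ((n : ℝ) + 2)⁻¹ • ∑ y ∈ K.1, y := by
  have hne : K.1.Nonempty := by rw [← Finset.card_pos, card_elem]; omega
  rw [Finset.centroid_eq_centerMass _ hne,
    Finset.centerMass_eq_of_sum_1 _ _ (K.1.sum_centroidWeights_eq_one_of_nonempty ℝ hne),
    Finset.smul_sum]
  refine Finset.sum_congr rfl fun y _ => ?_
  simp [Finset.centroidWeights, card_elem]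

/-- The centroid has distance η / (n + 2) from the face, and η |e| = (n + 1)|K|. The right-hand side
does not depend on the face, which is why one degree of freedom per element controls the pressure.
-/
lemma centroid_flux {K : T.elems} {e : T.faces} (heK : e.1 ⊆ K.1) {x : E (n + 1)}
    (hx : x ∈ convexHull ℝ (e.1 : Set (E (n + 1)))) :
    T.faceArea e * inner ℝ (x - K.1.centroid ℝ id) (O.outNormal K e)
      = ((n : ℝ) + 1) / ((n : ℝ) + 2) * T.elemVol K := by
  classical
  have hN := O.isOutwardNormal_outNormal heK
  obtain ⟨a, ha, hae, hK, η, hη, h⟩ := exists_height heK hN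
  set N := O.outNormal K e
  have hn2 : ((n : ℝ) + 2) ≠ 0 := by positivity
  have hxy : ∀ y ∈ K.1, inner ℝ N (x - y) = if y = a then η else 0 := by
    intro y hy
    have hxa := inner_hull_eq h x hx
    split_ifs with hya
    · rw [hya, hxa]
    · have hye : y ∈ e.1 := by
        have : y ∈ insert a (e.1 : Set (E (n + 1))) := hK ▸ hy
        exact this.resolve_left hya
      rw [← sub_sub_sub_cancel_right x y a, inner_sub_right, hxa, h y hye, sub_self]
  have hcen : x - K.1.centroid ℝ id = ((n : ℝ) + 2)⁻¹ • ∑ y ∈ K.1, (x - y) := by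
    rw [centroid_eq, Finset.sum_sub_distrib, Finset.sum_const, card_elem, smul_sub,
      ← Nat.cast_smul_eq_nsmul ℝ, smul_smul]
    push_cast
    rw [inv_mul_cancel₀ hn2, one_smul]
  rw [hcen, real_inner_comm, inner_smul_right, inner_sum, Finset.sum_congr rfl hxy,
    Finset.sum_ite_eq', if_pos ha]
  have := elemVol_eq hN.1 hK hη h
  field_simp
  linarith

/-- The element of `D_h` with coefficients `c`. -/
noncomputable def bubble (c : T.elems → ℝ) : T.VecP1 := fun K =>
  c K • (AffineMap.id ℝ (E (n + 1)) - AffineMap.const ℝ (E (n + 1)) (K.1.centroid ℝ id))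

lemma bubble_apply (c : T.elems → ℝ) (K : T.elems) (x : E (n + 1)) :
    bubble c K x = c K • (x - K.1.centroid ℝ id) := rfl

lemma bubble_mem_Dh (c : T.elems → ℝ) : bubble c ∈ T.Dh := fun K => ⟨c K, bubble_apply c K⟩

/-- Integrating q div w by parts on each element leaves face terms only. On an interior face the
integrand equals {w}·n_e [q], on a boundary face it is zero. -/
lemma b_eq (w : T.VecP1) (q : T.ScalP0) :
    O.b w q = ∑ e : T.faces, T.faceIntegral e fun x =>
      inner ℝ (O.jump e fun K => q K • w K x) (O.normal e)
        - inner ℝ (O.jump e fun K => w K x) (O.normal e) * O.avg e q := by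
  have h := sum_integral_by_parts O (fun K => q K • w K) (φ := fun _ => 1) contDiff_const
  have h1 : ∀ K : T.elems, T.elemIntegral K (fun x => fderiv ℝ (fun _ : E (n + 1) => (1 : ℝ)) x
      ((q K • w K) x) + 1 * divergence (q K • w K))
      = T.elemIntegral K fun _ => divergence (w K) * q K := by
    intro K
    congr 1
    funext x
    simp [divergence, mul_comm]
  rw [Finset.sum_congr rfl fun K _ => h1 K] at h
  unfold b
  rw [h, ← Finset.sum_sub_distrib]
  refine Finset.sum_congr rfl fun e _ => ?_
  have hj := continuous_jump O w e
  have hj' := continuous_jump O (fun K => q K • w K) e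
  simp only [one_mul]
  exact (integral_sub (integrableOn_face O e (by fun_prop))
    (integrableOn_face O e (by fun_prop))).symm

-- Dividing by |K| makes the outward flux through every face of K a fixed multiple of q_K. The
-- outward normals of neighbours are opposite, so {w}·n_e integrates to a multiple of [q], and b
-- becomes a sum of squares.
open Classical in
lemma b_bubble (q : T.ScalP0) :
    O.b (bubble fun K => q K / T.elemVol K) q
      = ∑ e : T.faces, if T.IsInterior e then
          ((n : ℝ) + 1) / ((n : ℝ) + 2) / 2 * (q (O.plus e) - q (O.minus e)) ^ 2 else 0 := by
  rw [b_eq]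
  refine Finset.sum_congr rfl fun e _ => ?_
  set w : T.VecP1 := bubble fun K => q K / T.elemVol K with hw
  have hA := faceArea_pos O e
  have hflux : ∀ K : T.elems, e.1 ⊆ K.1 → ∀ x ∈ convexHull ℝ (e.1 : Set (E (n + 1))),
      inner ℝ (w K x) (O.outNormal K e)
        = (T.faceArea e)⁻¹ * (((n : ℝ) + 1) / ((n : ℝ) + 2) * q K) := by
    intro K heK x hx
    have h1 := O.centroid_flux heK hx
    have h2 := elemVol_pos K
    rw [hw, bubble_apply, real_inner_smul_left, eq_inv_mul_iff_mul_eq₀ hA.ne']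
    calc _ = q K / T.elemVol K * (T.faceArea e * inner ℝ (x - K.1.centroid ℝ id) (O.outNormal K e)) :=
          by ring
      _ = _ := by rw [h1]; field_simp
  split_ifs with hint
  · rw [faceIntegral_congr (g := fun _ => (T.faceArea e)⁻¹ *
      (((n : ℝ) + 1) / ((n : ℝ) + 2) / 2 * (q (O.plus e) - q (O.minus e)) ^ 2)),
      faceIntegral_const, mul_inv_cancel_left₀ hA.ne']
    intro x hx
    have hp := hflux _ (O.subset_plus e) x hx
    have hm := hflux _ (O.subset_minus e) x hx
    rw [O.outNormal_plus] at hp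
    rw [O.outNormal_minus hint, inner_neg_right, neg_eq_iff_eq_neg] at hm
    simp only [jump, avg, if_pos hint, inner_sub_left, real_inner_smul_left, hp, hm, smul_eq_mul]
    ring
  · rw [faceIntegral_congr (g := fun _ => 0)]
    · simp [faceIntegral]
    · intro x hx
      simp only [jump, avg, if_neg hint, real_inner_smul_left]
      ring

/-- The form `b` restricted to `D_h` determines piecewise constants up to a constant. -/
theorem eq_of_b_bubble (hopen : IsOpen Ω) (hconn : IsConnected Ω)
    (hΩ : interior (closure Ω) = Ω) {q : T.ScalP0}
    (hq : O.b (bubble fun K => q K / T.elemVol K) q = 0) (K L : T.elems) : q K = q L := by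
  classical
  rw [b_bubble] at hq
  have hpos : (0 : ℝ) < ((n : ℝ) + 1) / ((n : ℝ) + 2) / 2 := by positivity
  rw [Finset.sum_eq_zero_iff_of_nonneg fun e _ => by split_ifs <;> positivity] at hq
  refine eq_of_face_neighbors hopen hconn hΩ (fun e K L heK heL => ?_) K L
  by_cases hint : T.IsInterior e
  · have h := hq e (Finset.mem_univ e)
    rw [if_pos hint, mul_eq_zero, or_iff_right hpos.ne', sq_eq_zero_iff, sub_eq_zero] at h
    rcases O.eq_plus_or_minus hint heK with rfl | rfl <;>
    rcases O.eq_plus_or_minus hint heL with rfl | rfl <;> simp [h]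
  · rw [O.eq_plus hint heK, O.eq_plus hint heL]

lemma eq_zero_of_mem_Qh (hconn : IsConnected Ω) (hΩ : interior (closure Ω) = Ω) {q : T.ScalP0}
    (hq : q ∈ T.Qh) (hc : ∀ K L, q K = q L) : q = 0 := by
  have h : ∫ x in Ω, T.scalFun q x = 0 := hq
  rw [scalFun, integral_glue hΩ fun K => continuous_const] at h
  simp only [elemIntegral_const] at h
  obtain ⟨K₀⟩ := elems_nonempty (T := T) hconn
  rw [Finset.sum_congr rfl fun K _ => by rw [hc K K₀], ← Finset.sum_mul] at h
  have : Nonempty T.elems := ⟨K₀⟩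
  have hpos : 0 < ∑ K : T.elems, T.elemVol K :=
    Finset.sum_pos (fun K _ => elemVol_pos K) Finset.univ_nonempty
  funext K
  rw [hc K K₀]
  exact (mul_eq_zero.1 h).resolve_left hpos.ne'

end Orientation

end Mesh

end Coercivity

/-! ### The velocity space is a subspace -/

section VelocitySpace

variable {d : ℕ} {Ω : Set (E d)}

lemma IsTestFunction.add {F : Type*} [NormedAddCommGroup F] [NormedSpace ℝ F] {φ ψ : E d → F}
    (hφ : IsTestFunction Ω φ) (hψ : IsTestFunction Ω ψ) : IsTestFunction Ω (φ + ψ) :=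
  ⟨hφ.1.add hψ.1, hφ.2.1.add hψ.2.1, (tsupport_add φ ψ).trans (union_subset hφ.2.2 hψ.2.2)⟩

lemma IsTestFunction.const_smul {F : Type*} [NormedAddCommGroup F] [NormedSpace ℝ F] {φ : E d → F}
    (hφ : IsTestFunction Ω φ) (c : ℝ) : IsTestFunction Ω (c • φ) := by
  have h : tsupport (c • φ) ⊆ tsupport φ := closure_mono (Function.support_const_smul_subset c φ)
  exact ⟨hφ.1.const_smul c, hφ.2.1.mono' (subset_closure.trans h), h.trans hφ.2.2⟩

/-- On a set of finite measure L² lies in L¹, and the test function is bounded; this integrability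
is what allows weak identities to be added. -/
lemma integrable_test_smul [IsFiniteMeasure (volume.restrict Ω)] {u : E d → E d}
    (hu : MemLp u 2 (volume.restrict Ω)) {φ : E d → ℝ} (hφ : Continuous φ)
    (hφc : HasCompactSupport φ) : Integrable (fun x => φ x • u x) (volume.restrict Ω) := by
  obtain ⟨C, hC⟩ := hφc.exists_bound_of_continuous hφ
  exact (hu.integrable one_le_two).bdd_smul C hφ.aestronglyMeasurable (Eventually.of_forall hC)

lemma IsTestFunction.fderiv_apply {φ : E d → ℝ} (hφ : IsTestFunction Ω φ) (z : E d) :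
    Continuous (fun x => fderiv ℝ φ x z) ∧ HasCompactSupport (fun x => fderiv ℝ φ x z) :=
  ⟨(hφ.1.continuous_fderiv (by simp)).clm_apply continuous_const, hφ.2.1.fderiv_apply ℝ z⟩

lemma memLp_clm_apply {G : E d → E d →L[ℝ] E d} (hG : MemLp G 2 (volume.restrict Ω)) (z : E d) :
    MemLp (fun x => G x z) 2 (volume.restrict Ω) :=
  (ContinuousLinearMap.apply ℝ (E d) z).comp_memLp' hG

section Convergence

variable {X F : Type*} [MeasurableSpace X] {μ : Measure X} [NormedAddCommGroup F]
  {f g : ℕ → X → F} {u v : X → F}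

lemma tendsto_eLpNorm_sub_add (hf : ∀ k, AEStronglyMeasurable (f k) μ)
    (hg : ∀ k, AEStronglyMeasurable (g k) μ) (hu : AEStronglyMeasurable u μ)
    (hv : AEStronglyMeasurable v μ)
    (hfu : Tendsto (fun k => eLpNorm (fun x => f k x - u x) 2 μ) atTop (𝓝 0))
    (hgv : Tendsto (fun k => eLpNorm (fun x => g k x - v x) 2 μ) atTop (𝓝 0)) :
    Tendsto (fun k => eLpNorm (fun x => f k x + g k x - (u x + v x)) 2 μ) atTop (𝓝 0) := by
  refine tendsto_of_tendsto_of_tendsto_of_le_of_le tendsto_const_nhds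
    (by simpa using hfu.add hgv) (fun _ => zero_le) fun k => ?_
  have : (fun x => f k x + g k x - (u x + v x)) = (fun x => f k x - u x) + fun x => g k x - v x :=
    funext fun x => add_sub_add_comm _ _ _ _
  simp only [this]
  exact eLpNorm_add_le ((hf k).sub hu) ((hg k).sub hv) one_le_two

lemma tendsto_eLpNorm_sub_smul [NormedSpace ℝ F] (c : ℝ)
    (hfu : Tendsto (fun k => eLpNorm (fun x => f k x - u x) 2 μ) atTop (𝓝 0)) :
    Tendsto (fun k => eLpNorm (fun x => c • f k x - c • u x) 2 μ) atTop (𝓝 0) := by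
  have : ∀ k, (fun x => c • f k x - c • u x) = c • fun x => f k x - u x :=
    fun k => funext fun x => (smul_sub c _ _).symm
  simp only [this, eLpNorm_const_smul]
  simpa using ENNReal.Tendsto.const_mul hfu (Or.inr (enorm_ne_top (x := c)))

lemma memLp_two_add (hu : MemLp u 2 μ) (hv : MemLp v 2 μ) : MemLp (fun x => u x + v x) 2 μ :=
  hu.add hv

lemma tendsto_eLpNorm_sub_of_eq (h : ∀ k x, f k x = u x) :
    Tendsto (fun k => eLpNorm (fun x => f k x - u x) 2 μ) atTop (𝓝 0) := by
  simp [h]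

end Convergence

lemma MemH10.zero : MemH10 Ω (fun _ => 0 : E d → E d) := by
  refine ⟨MemLp.zero', fun _ => 0, MemLp.zero' (ε := E d →L[ℝ] E d), fun φ _ z => by simp,
    fun _ _ => 0, fun _ => ?_, ?_, ?_⟩
  · exact ⟨contDiff_const, HasCompactSupport.zero, by simp [tsupport]⟩
  · exact tendsto_eLpNorm_sub_of_eq fun _ _ => rfl
  · exact tendsto_eLpNorm_sub_of_eq fun _ x => by rw [fderiv_fun_const]; rfl

lemma IsWeakGradient.add [IsFiniteMeasure (volume.restrict Ω)] {u v : E d → E d}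
    {G H : E d → E d →L[ℝ] E d} (hu : MemLp u 2 (volume.restrict Ω))
    (hv : MemLp v 2 (volume.restrict Ω)) (hG : MemLp G 2 (volume.restrict Ω))
    (hH : MemLp H 2 (volume.restrict Ω)) (hGw : IsWeakGradient Ω u G)
    (hHw : IsWeakGradient Ω v H) :
    IsWeakGradient Ω (fun x => u x + v x) (fun x => G x + H x) := by
  intro θ hθ z
  obtain ⟨h1, h2⟩ := hθ.fderiv_apply z
  have hGz := integrable_test_smul (memLp_clm_apply hG z) hθ.1.continuous hθ.2.1
  have hHz := integrable_test_smul (memLp_clm_apply hH z) hθ.1.continuous hθ.2.1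
  have e1 : ∀ x, θ x • (G x + H x) z = θ x • G x z + θ x • H x z := fun x => by
    rw [add_apply, smul_add]
  simp only [e1, smul_add]
  rw [integral_add (integrable_test_smul hu h1 h2)
      (integrable_test_smul hv h1 h2), integral_add hGz hHz,
    hGw θ hθ z, hHw θ hθ z, neg_add]

lemma MemH10.add [IsFiniteMeasure (volume.restrict Ω)] {u v : E d → E d} (hu : MemH10 Ω u)
    (hv : MemH10 Ω v) : MemH10 Ω (fun x => u x + v x) := by
  obtain ⟨hu2, G, hG, hGw, φ, hφ, hφu, hφG⟩ := hu
  obtain ⟨hv2, H, hH, hHw, ψ, hψ, hψv, hψH⟩ := hv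
  refine ⟨hu2.add hv2, fun x => G x + H x,
    memLp_two_add (F := E d →L[ℝ] E d) hG hH,
    IsWeakGradient.add hu2 hv2 hG hH hGw hHw, fun k => φ k + ψ k,
    fun k => (hφ k).add (hψ k), ?_, ?_⟩
  · exact tendsto_eLpNorm_sub_add (fun k => (hφ k).1.continuous.aestronglyMeasurable)
      (fun k => (hψ k).1.continuous.aestronglyMeasurable) hu2.1 hv2.1 hφu hψv
  · have hd : ∀ k x, fderiv ℝ (φ k + ψ k) x = fderiv ℝ (φ k) x + fderiv ℝ (ψ k) x := fun k x =>
      fderiv_add ((hφ k).1.differentiable (by simp) x) ((hψ k).1.differentiable (by simp) x)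
    simp only [hd]
    exact tendsto_eLpNorm_sub_add
      (fun k => ((hφ k).1.continuous_fderiv (by simp)).aestronglyMeasurable)
      (fun k => ((hψ k).1.continuous_fderiv (by simp)).aestronglyMeasurable) hG.1 hH.1 hφG hψH

lemma MemH10.const_smul {u : E d → E d} (hu : MemH10 Ω u) (c : ℝ) :
    MemH10 Ω (fun x => c • u x) := by
  obtain ⟨hu2, G, hG, hGw, φ, hφ, hφu, hφG⟩ := hu
  refine ⟨hu2.const_smul c, fun x => c • G x, hG.const_smul c, ?_, fun k => c • φ k,
    fun k => (hφ k).const_smul c, tendsto_eLpNorm_sub_smul c hφu, ?_⟩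
  · intro θ hθ z
    simp only [smul_apply, smul_comm _ c]
    rw [integral_smul, integral_smul, hGw θ hθ z, smul_neg]
  · have hd : ∀ k x, fderiv ℝ (c • φ k) x = c • fderiv ℝ (φ k) x := fun k x =>
      fderiv_const_smul ((hφ k).1.differentiable (by simp) x) c
    simp only [hd]
    exact tendsto_eLpNorm_sub_smul c hφG

namespace Mesh

variable {T : Mesh d Ω}

lemma glue_add {F : Type*} [AddCommGroup F] (f g : T.elems → E d → F) :
    T.glue (fun K x => f K x + g K x) = T.glue f + T.glue g := by
  funext x
  simp only [glue, Pi.add_apply, ← Finset.sum_add_distrib]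
  exact Finset.sum_congr rfl fun K _ => congrFun (indicator_add _ _ _) x

lemma glue_smul {F : Type*} [AddCommGroup F] [Module ℝ F] (c : ℝ) (f : T.elems → E d → F) :
    T.glue (fun K x => c • f K x) = c • T.glue f := by
  funext x
  simp only [glue, Pi.smul_apply, Finset.smul_sum]
  exact Finset.sum_congr rfl fun K _ => congrFun (indicator_const_smul _ c (f K)) x

lemma vecFun_add (v w : T.VecP1) : T.vecFun (v + w) = T.vecFun v + T.vecFun w :=
  glue_add (fun K x => v K x) fun K x => w K x

lemma vecFun_smul (c : ℝ) (v : T.VecP1) : T.vecFun (c • v) = c • T.vecFun v :=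
  glue_smul c fun K x => v K x

lemma zero_mem_Ch : (0 : T.VecP1) ∈ T.Ch := by
  have h := T.vecFun_smul 0 0
  rw [zero_smul, zero_smul] at h
  change MemH10 Ω (T.vecFun 0)
  rw [h]
  exact MemH10.zero

variable (T) in
/-- `V_h` as a subspace. -/
def VhSubmodule [IsFiniteMeasure (volume.restrict Ω)] : Submodule ℝ T.VecP1 where
  carrier := T.Vh
  zero_mem' := ⟨0, zero_mem_Ch, 0, fun K => ⟨0, fun x => by simp⟩, by simp⟩
  add_mem' := by
    rintro _ _ ⟨vC, hvC, vD, hvD, rfl⟩ ⟨wC, hwC, wD, hwD, rfl⟩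
    refine ⟨vC + wC, ?_, vD + wD, fun K => ?_, by abel⟩
    · change MemH10 Ω _
      rw [vecFun_add]
      exact MemH10.add hvC hwC
    · obtain ⟨c, hc⟩ := hvD K
      obtain ⟨c', hc'⟩ := hwD K
      exact ⟨c + c', fun x => by simp [hc, hc', add_smul]⟩
  smul_mem' := by
    rintro r _ ⟨vC, hvC, vD, hvD, rfl⟩
    refine ⟨r • vC, ?_, r • vD, fun K => ?_, by simp⟩
    · change MemH10 Ω _
      rw [vecFun_smul]
      exact MemH10.const_smul hvC r
    · obtain ⟨c, hc⟩ := hvD K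
      exact ⟨r * c, fun x => by simp [hc, mul_smul]⟩

lemma Dh_subset_Vh : T.Dh ⊆ T.Vh := fun v hv => ⟨0, zero_mem_Ch, v, hv, by simp⟩

end Mesh

end VelocitySpace

/-! ### The discrete problem as a linear system -/

section LinearSystem

/-- A square saddle point system with trivial kernel is uniquely solvable. -/
theorem existsUnique_saddle_point {X Y : Type*} [AddCommGroup X] [Module ℝ X] [AddCommGroup Y]
    [Module ℝ Y] [FiniteDimensional ℝ X] [FiniteDimensional ℝ Y]
    (a : X →ₗ[ℝ] X →ₗ[ℝ] ℝ) (b : X →ₗ[ℝ] Y →ₗ[ℝ] ℝ) (V : Submodule ℝ X) (Q : Submodule ℝ Y)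
    (h : ∀ u ∈ V, ∀ p ∈ Q, (∀ v ∈ V, a u v - b v p = 0) → (∀ q ∈ Q, b u q = 0) → u = 0 ∧ p = 0)
    (ℓ : X →ₗ[ℝ] ℝ) :
    ∃! up : X × Y, up.1 ∈ V ∧ up.2 ∈ Q ∧ (∀ v ∈ V, a up.1 v - b v up.2 = ℓ v) ∧
      ∀ q ∈ Q, b up.1 q = 0 := by
  -- The system as a map from V × Q to the product of the duals. Dimensions agree, so a trivial
  -- kernel yields surjectivity.
  let Φ : (V × Q) →ₗ[ℝ] (Module.Dual ℝ V × Module.Dual ℝ Q) :=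
    LinearMap.prod
      ((a.compl₁₂ V.subtype V.subtype).comp (LinearMap.fst ℝ V Q)
        - (b.flip.compl₁₂ Q.subtype V.subtype).comp (LinearMap.snd ℝ V Q))
      ((b.compl₁₂ V.subtype Q.subtype).comp (LinearMap.fst ℝ V Q))
  have hΦ1 : ∀ (u p v), (Φ (u, p)).1 v = a u.1 v.1 - b v.1 p.1 := fun u p v => by simp [Φ]
  have hΦ2 : ∀ (u p q), (Φ (u, p)).2 q = b u.1 q.1 := fun u p q => by simp [Φ]
  have hinj : Function.Injective Φ := by
    rw [← LinearMap.ker_eq_bot, LinearMap.ker_eq_bot']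
    rintro ⟨u, p⟩ hup
    have h1 : ∀ v, (Φ (u, p)).1 v = 0 := fun v => by rw [hup]; rfl
    have h2 : ∀ q, (Φ (u, p)).2 q = 0 := fun q => by rw [hup]; rfl
    obtain ⟨hu, hp⟩ := h u.1 u.2 p.1 p.2 (fun v hv => (hΦ1 u p ⟨v, hv⟩).symm.trans (h1 _))
      fun q hq => (hΦ2 u p ⟨q, hq⟩).symm.trans (h2 _)
    exact Prod.ext (Subtype.ext hu) (Subtype.ext hp)
  have hsurj : Function.Surjective Φ :=
    (LinearMap.injective_iff_surjective_of_finrank_eq_finrank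
      (by simp [Module.finrank_prod, Subspace.dual_finrank_eq])).1 hinj
  obtain ⟨⟨u, p⟩, hup⟩ := hsurj (ℓ.comp V.subtype, 0)
  refine ⟨(u.1, p.1), ⟨u.2, p.2, fun v hv => ?_, fun q hq => ?_⟩, ?_⟩
  · rw [← hΦ1 u p ⟨v, hv⟩, hup]; rfl
  · rw [← hΦ2 u p ⟨q, hq⟩, hup]; rfl
  · rintro ⟨u', p'⟩ ⟨hu', hp', h1, h2⟩
    have : Φ (⟨u', hu'⟩, ⟨p', hp'⟩) = Φ (u, p) := by
      rw [hup]
      refine Prod.ext (LinearMap.ext fun v => ?_) (LinearMap.ext fun q => ?_)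
      · rw [hΦ1]; exact h1 v.1 v.2
      · rw [hΦ2]; exact h2 q.1 q.2
    have := hinj this
    simp only [Prod.mk.injEq] at this
    exact Prod.ext (Subtype.ext_iff.1 this.1) (Subtype.ext_iff.1 this.2)

/-! ### Bilinearity of the forms. -/

variable {n : ℕ} {Ω : Set (E (n + 1))}

namespace Mesh

lemma frob_comm (L M : E (n + 1) →ₗ[ℝ] E (n + 1)) : frob L M = frob M L := by
  simp only [frob, real_inner_comm]

lemma frob_add_right (L M M' : E (n + 1) →ₗ[ℝ] E (n + 1)) :
    frob L (M + M') = frob L M + frob L M' := by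
  simp [frob, inner_add_right, Finset.sum_add_distrib]

lemma frob_smul_right (c : ℝ) (L M : E (n + 1) →ₗ[ℝ] E (n + 1)) :
    frob L (c • M) = c * frob L M := by
  simp [frob, inner_smul_right, Finset.mul_sum]

lemma divergence_add (A B : E (n + 1) →ᵃ[ℝ] E (n + 1)) :
    divergence (A + B) = divergence A + divergence B := by
  simp [divergence]

lemma divergence_smul (c : ℝ) (A : E (n + 1) →ᵃ[ℝ] E (n + 1)) :
    divergence (c • A) = c * divergence A := by
  simp [divergence]

namespace Orientation

variable {T : Mesh (n + 1) Ω} (O : T.Orientation) {F : Type*} [AddCommGroup F] [Module ℝ F]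

lemma avg_add (e : T.faces) (y z : T.elems → F) :
    (O.avg e fun K => y K + z K) = O.avg e y + O.avg e z := by
  unfold avg
  split_ifs
  · rw [← smul_add, add_add_add_comm]
  · rfl

lemma avg_smul (e : T.faces) (c : ℝ) (y : T.elems → F) :
    (O.avg e fun K => c • y K) = c • O.avg e y := by
  unfold avg
  split_ifs
  · rw [← smul_add, smul_comm]
  · rfl

lemma jump_add {F : Type*} [AddCommGroup F] (e : T.faces) (y z : T.elems → F) :
    (O.jump e fun K => y K + z K) = O.jump e y + O.jump e z := by
  unfold jump
  split_ifs
  · exact add_sub_add_comm _ _ _ _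
  · rfl

lemma jump_smul (e : T.faces) (c : ℝ) (y : T.elems → F) :
    (O.jump e fun K => c • y K) = c • O.jump e y := by
  unfold jump
  split_ifs
  · rw [smul_sub]
  · rfl

variable (T) in
/-- The bilinear form of the broken gradients. -/
noncomputable def gradForm : T.VecP1 →ₗ[ℝ] T.VecP1 →ₗ[ℝ] ℝ :=
  LinearMap.mk₂ ℝ (fun v w => ∑ K : T.elems, T.elemIntegral K fun _ =>
      frob (v K).linear (w K).linear)
    (fun v v' w => by
      simp only [elemIntegral_const, ← Finset.sum_add_distrib, ← mul_add, frob_comm _ (w _).linear,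
        Pi.add_apply, AffineMap.add_linear, frob_add_right])
    (fun c v w => by
      simp only [elemIntegral_const, smul_eq_mul, Finset.mul_sum, frob_comm _ (w _).linear,
        Pi.smul_apply, AffineMap.smul_linear, frob_smul_right, mul_left_comm])
    (fun v w w' => by
      simp only [elemIntegral_const, ← Finset.sum_add_distrib, ← mul_add,
        Pi.add_apply, AffineMap.add_linear, frob_add_right])
    (fun c v w => by
      simp only [elemIntegral_const, smul_eq_mul, Finset.mul_sum,
        Pi.smul_apply, AffineMap.smul_linear, frob_smul_right, mul_left_comm])

/-- `consistency` as a bilinear form. -/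
noncomputable def consistencyForm : T.VecP1 →ₗ[ℝ] T.VecP1 →ₗ[ℝ] ℝ :=
  LinearMap.mk₂ ℝ O.consistency
    (fun v v' w => by
      simp only [consistency, ← Finset.sum_add_distrib]
      refine Finset.sum_congr rfl fun e _ => ?_
      have := continuous_jump O w e
      rw [← faceIntegral_add O e (by fun_prop) (by fun_prop)]
      simp only [← inner_add_left, ← avg_add]
      rfl)
    (fun c v w => by
      simp only [consistency, smul_eq_mul, Finset.mul_sum]
      refine Finset.sum_congr rfl fun e _ => ?_
      rw [← faceIntegral_const_mul]
      simp only [← real_inner_smul_left, ← avg_smul]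
      rfl)
    (fun v w w' => by
      simp only [consistency, ← Finset.sum_add_distrib]
      refine Finset.sum_congr rfl fun e _ => ?_
      have := continuous_jump O w e
      have := continuous_jump O w' e
      rw [← faceIntegral_add O e (by fun_prop) (by fun_prop)]
      simp only [← inner_add_right, ← jump_add]
      rfl)
    (fun c v w => by
      simp only [consistency, smul_eq_mul, Finset.mul_sum]
      refine Finset.sum_congr rfl fun e _ => ?_
      rw [← faceIntegral_const_mul]
      simp only [← real_inner_smul_right, ← jump_smul]
      rfl)

/-- The penalty term as a bilinear form. -/
noncomputable def penaltyForm : T.VecP1 →ₗ[ℝ] T.VecP1 →ₗ[ℝ] ℝ :=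
  LinearMap.mk₂ ℝ (fun v w => ∑ e : T.faces, T.faceIntegral e fun x =>
        (T.faceSize e)⁻¹ * inner ℝ (O.jump e fun K => w K x) (O.jump e fun K => v K x))
    (fun v v' w => by
      simp only [← Finset.sum_add_distrib]
      refine Finset.sum_congr rfl fun e _ => ?_
      have := continuous_jump O w e
      have := continuous_jump O v e
      have := continuous_jump O v' e
      rw [← faceIntegral_add O e (by fun_prop) (by fun_prop)]
      simp only [← mul_add, ← inner_add_right, ← jump_add]
      rfl)
    (fun c v w => by
      simp only [smul_eq_mul, Finset.mul_sum]
      refine Finset.sum_congr rfl fun e _ => ?_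
      rw [← faceIntegral_const_mul]
      congr 1
      funext x
      rw [mul_left_comm, ← real_inner_smul_right _ _ c, ← jump_smul]
      rfl)
    (fun v w w' => by
      simp only [← Finset.sum_add_distrib]
      refine Finset.sum_congr rfl fun e _ => ?_
      have := continuous_jump O w e
      have := continuous_jump O w' e
      have := continuous_jump O v e
      rw [← faceIntegral_add O e (by fun_prop) (by fun_prop)]
      simp only [← mul_add, ← inner_add_left, ← jump_add]
      rfl)
    (fun c v w => by
      simp only [smul_eq_mul, Finset.mul_sum]
      refine Finset.sum_congr rfl fun e _ => ?_
      rw [← faceIntegral_const_mul]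
      congr 1
      funext x
      rw [mul_left_comm, ← real_inner_smul_left (O.jump e fun K => w K x), ← jump_smul]
      rfl)

/-- `a` as a bilinear form. -/
noncomputable def aForm (ν ρ : ℝ) : T.VecP1 →ₗ[ℝ] T.VecP1 →ₗ[ℝ] ℝ :=
  ν • (gradForm T - O.consistencyForm - O.consistencyForm.flip + ρ • O.penaltyForm)

/-- `b` as a bilinear form. -/
noncomputable def bForm : T.VecP1 →ₗ[ℝ] T.ScalP0 →ₗ[ℝ] ℝ :=
  LinearMap.mk₂ ℝ O.b
    (fun w w' q => by
      have h : ∀ e : T.faces, T.faceIntegral e (fun x =>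
          inner ℝ (O.jump e fun K => (w + w') K x) (O.normal e) * O.avg e q)
          = T.faceIntegral e (fun x => inner ℝ (O.jump e fun K => w K x) (O.normal e) * O.avg e q)
          + T.faceIntegral e
              (fun x => inner ℝ (O.jump e fun K => w' K x) (O.normal e) * O.avg e q) := by
        intro e
        have := continuous_jump O w e
        have := continuous_jump O w' e
        rw [← faceIntegral_add O e (by fun_prop) (by fun_prop)]
        simp only [← add_mul, ← inner_add_left, ← jump_add]
        rfl
      simp only [b, elemIntegral_const, h]
      simp only [Finset.sum_add_distrib, Pi.add_apply, divergence_add, add_mul, mul_add]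
      ring)
    (fun c w q => by
      have h : ∀ e : T.faces, T.faceIntegral e (fun x =>
          inner ℝ (O.jump e fun K => (c • w) K x) (O.normal e) * O.avg e q)
          = c * T.faceIntegral e
              (fun x => inner ℝ (O.jump e fun K => w K x) (O.normal e) * O.avg e q) := by
        intro e
        rw [← faceIntegral_const_mul]
        simp only [← mul_assoc, ← real_inner_smul_left, ← jump_smul]
        rfl
      simp only [b, elemIntegral_const, h]
      simp only [Pi.smul_apply, divergence_smul, smul_eq_mul, mul_sub, Finset.mul_sum]
      congr 1
      exact Finset.sum_congr rfl fun K _ => by ring)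
    (fun w q q' => by
      have h : ∀ e : T.faces, T.faceIntegral e (fun x =>
          inner ℝ (O.jump e fun K => w K x) (O.normal e) * O.avg e (q + q'))
          = T.faceIntegral e (fun x => inner ℝ (O.jump e fun K => w K x) (O.normal e) * O.avg e q)
          + T.faceIntegral e
              (fun x => inner ℝ (O.jump e fun K => w K x) (O.normal e) * O.avg e q') := by
        intro e
        have := continuous_jump O w e
        rw [← faceIntegral_add O e (by fun_prop) (by fun_prop)]
        simp only [← mul_add, ← avg_add]
        rfl
      simp only [b, elemIntegral_const, h, Finset.sum_add_distrib, Pi.add_apply, mul_add]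
      ring)
    (fun c w q => by
      have h : ∀ e : T.faces, T.faceIntegral e (fun x =>
          inner ℝ (O.jump e fun K => w K x) (O.normal e) * O.avg e (c • q))
          = c * T.faceIntegral e
              (fun x => inner ℝ (O.jump e fun K => w K x) (O.normal e) * O.avg e q) := by
        intro e
        rw [← faceIntegral_const_mul]
        congr 1
        funext x
        have : O.avg e (c • q) = c • O.avg e q := O.avg_smul e c q
        rw [this, smul_eq_mul]
        ring
      simp only [b, elemIntegral_const, h, Pi.smul_apply, smul_eq_mul, mul_sub, Finset.mul_sum]
      congr 1
      exact Finset.sum_congr rfl fun K _ => by ring)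

variable (T) in
/-- `Q_h` as a subspace. -/
def QhSubmodule (hΩ : interior (closure Ω) = Ω) : Submodule ℝ T.ScalP0 where
  carrier := T.Qh
  zero_mem' := by
    change ∫ x in Ω, T.glue _ x = 0
    rw [integral_glue hΩ fun K => continuous_const]
    simp [elemIntegral_const]
  add_mem' := by
    intro p q hp hq
    change ∫ x in Ω, T.glue _ x = 0 at *
    rw [integral_glue hΩ fun K => continuous_const] at *
    simp only [elemIntegral_const, Pi.add_apply, mul_add, Finset.sum_add_distrib] at *
    rw [hp, hq, add_zero]
  smul_mem' := by
    intro c q hq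
    change ∫ x in Ω, T.glue _ x = 0 at *
    rw [integral_glue hΩ fun K => continuous_const] at *
    simp only [elemIntegral_const, Pi.smul_apply, smul_eq_mul, mul_left_comm _ c,
      ← Finset.mul_sum] at *
    rw [hq, mul_zero]

/-! ### Linearity of the reconstruction and of the load, then unique solvability. -/

lemma isReconstruction_recon (hΩ : interior (closure Ω) = Ω) (v : T.VecP1) :
    O.IsReconstruction v (O.recon v) := by
  unfold recon
  rw [dif_pos (O.exists_reconstruction hΩ v)]
  exact (O.exists_reconstruction hΩ v).choose_spec

/-- The moment conditions are linear in (v, w), so the sum of reconstructions has the moments of the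
sum, and uniqueness identifies it. -/
lemma recon_add (hΩ : interior (closure Ω) = Ω) (v v' : T.VecP1) :
    O.recon (v + v') = O.recon v + O.recon v' := by
  have h := O.isReconstruction_recon hΩ v
  have h' := O.isReconstruction_recon hΩ v'
  have hsum : ∀ (e : T.faces) (w w' : E (n + 1) → E (n + 1)) (p : E (n + 1) →ᵃ[ℝ] ℝ),
      Continuous w → Continuous w' →
      T.faceIntegral e (fun x => inner ℝ (w x + w' x) (O.normal e) * p x)
        = T.faceIntegral e (fun x => inner ℝ (w x) (O.normal e) * p x)
          + T.faceIntegral e (fun x => inner ℝ (w' x) (O.normal e) * p x) := by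
    intro e w w' p hw hw'
    have := continuous_affine p
    rw [← faceIntegral_add O e (by fun_prop) (by fun_prop)]
    simp only [inner_add_left, add_mul]
  refine O.normalMoments_unique (O.isReconstruction_recon hΩ (v + v')).2
    ⟨fun e hint K heK p => ?_, fun e hint K heK p => ?_⟩
  · refine (hsum e _ _ p (continuous_affine _) (continuous_affine _)).trans ?_
    rw [h.2.1 e hint K heK p, h'.2.1 e hint K heK p,
      ← hsum e _ _ p (continuous_avg O v e) (continuous_avg O v' e)]
    simp only [← avg_add]
    rfl
  · refine (hsum e _ _ p (continuous_affine _) (continuous_affine _)).trans ?_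
    rw [h.2.2 e hint K heK p, h'.2.2 e hint K heK p, add_zero]

lemma recon_smul (hΩ : interior (closure Ω) = Ω) (c : ℝ) (v : T.VecP1) :
    O.recon (c • v) = c • O.recon v := by
  have h := O.isReconstruction_recon hΩ v
  have hsmul : ∀ (e : T.faces) (w : E (n + 1) → E (n + 1)) (p : E (n + 1) →ᵃ[ℝ] ℝ),
      T.faceIntegral e (fun x => inner ℝ (c • w x) (O.normal e) * p x)
        = c * T.faceIntegral e (fun x => inner ℝ (w x) (O.normal e) * p x) := by
    intro e w p
    rw [← faceIntegral_const_mul]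
    simp only [real_inner_smul_left, mul_assoc]
  refine O.normalMoments_unique (O.isReconstruction_recon hΩ (c • v)).2
    ⟨fun e hint K heK p => ?_, fun e hint K heK p => ?_⟩
  · refine (hsmul e _ p).trans ?_
    rw [h.2.1 e hint K heK p, ← hsmul]
    simp only [← avg_smul]
    rfl
  · refine (hsmul e _ p).trans ?_
    rw [h.2.2 e hint K heK p, mul_zero]

lemma integrable_inner_vecFun {f : E (n + 1) → E (n + 1)} (hf : MemLp f 2 (volume.restrict Ω))
    (w : T.VecP1) : Integrable (fun x => inner ℝ (f x) (T.vecFun w x)) (volume.restrict Ω) := by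
  have hw : MemLp (T.vecFun w) 2 (volume.restrict Ω) := memLp_glue fun K => continuous_affine (w K)
  exact (hf.norm.integrable_mul hw.norm).mono' (hf.1.inner hw.1)
    (Eventually.of_forall fun x => norm_inner_le_norm _ _)

/-- The right-hand side of the scheme as a linear functional. -/
noncomputable def loadForm (hΩ : interior (closure Ω) = Ω) {f : E (n + 1) → E (n + 1)}
    (hf : MemLp f 2 (volume.restrict Ω)) : T.VecP1 →ₗ[ℝ] ℝ where
  toFun v := ∫ x in Ω, inner ℝ (f x) (T.vecFun (O.recon v) x)
  map_add' v v' := by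
    rw [← integral_add (integrable_inner_vecFun hf _) (integrable_inner_vecFun hf _)]
    simp only [O.recon_add hΩ, vecFun_add, Pi.add_apply, inner_add_right]
  map_smul' c v := by
    simp only [O.recon_smul hΩ, vecFun_smul, Pi.smul_apply, inner_smul_right, RingHom.id_apply,
      smul_eq_mul]
    exact integral_const_mul c _

/-- Unique solvability of the scheme. -/
theorem existsUnique_solution (hn : n ≠ 0) (hopen : IsOpen Ω) (hbdd : Bornology.IsBounded Ω)
    (hconn : IsConnected Ω) (hΩ : interior (closure Ω) = Ω) {σ : ℝ} (hσ : T.IsShapeRegular σ)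
    {ν ρ : ℝ} (hν : 0 < ν) (hρ : penaltyThreshold n σ ≤ ρ) {f : E (n + 1) → E (n + 1)}
    (hf : MemLp f 2 (volume.restrict Ω)) :
    ∃! up : T.VecP1 × T.ScalP0, O.IsSolution ν ρ f up.1 up.2 := by
  have : IsFiniteMeasure (volume.restrict Ω) := ⟨by simpa using hbdd.measure_lt_top⟩
  refine existsUnique_saddle_point (O.aForm ν ρ) O.bForm T.VhSubmodule (QhSubmodule T hΩ) ?_
    (O.loadForm hΩ hf)
  intro u hu p hp h1 h2
  -- Test with v = u; the pressure term drops out by the second equation at q = p.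
  have hu0 : u = 0 := by
    have h3 := h1 u hu
    rw [h2 p hp, sub_zero] at h3
    exact O.eq_zero_of_a_self hn hopen hconn hΩ hσ hν hρ h3
  refine ⟨hu0, eq_zero_of_mem_Qh hconn hΩ hp ?_⟩
  refine O.eq_of_b_bubble hopen hconn hΩ ?_
  -- With u = 0 the first equation says that b(·, p) vanishes on V_h, in particular on this field of
  -- D_h.
  have h3 := h1 _ (Dh_subset_Vh (bubble_mem_Dh fun K => p K / T.elemVol K))
  rw [hu0, map_zero, LinearMap.zero_apply, zero_sub, neg_eq_zero] at h3
  exact h3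

end Orientation

end Mesh

end LinearSystem

end StokesEG

open StokesEG MeasureTheory in
/-- Well-posedness of the pressure-robust enriched Galerkin scheme: the threshold `ρ₀` depends only
on the dimension and on the shape-regularity constant `σ`. The first part of the conclusion says
that the velocity reconstruction in the right-hand side of the scheme is well defined. -/
theorem mainTheorem2 (d : ℕ) (hd : d = 2 ∨ d = 3) (σ : ℝ) :
    ∃ ρ₀ : ℝ, 0 < ρ₀ ∧
      ∀ (Ω : Set (E d)), IsOpen Ω → Bornology.IsBounded Ω → IsConnected Ω →
        interior (closure Ω) = Ω →
      ∀ (T : Mesh d Ω), T.IsShapeRegular σ → ∀ (O : T.Orientation),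
        (∀ v ∈ T.Vh, ∃! w : T.VecP1, O.IsReconstruction v w) ∧
        ∀ (ν ρ : ℝ), 0 < ν → ρ₀ ≤ ρ →
          ∀ f : E d → E d, MemLp f 2 (volume.restrict Ω) →
            ∃! up : T.VecP1 × T.ScalP0, O.IsSolution ν ρ f up.1 up.2 := by
  -- Faces have dimension n = d - 1; n ≠ 0 is what gives the root h_e = |e|^(1/n) its scaling in the
  -- trace estimate.
  obtain ⟨n, hn, rfl⟩ : ∃ n : ℕ, n ≠ 0 ∧ d = n + 1 := ⟨d - 1, by omega, by omega⟩
  refine ⟨Mesh.Orientation.penaltyThreshold n σ, Mesh.Orientation.penaltyThreshold_pos n σ,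
    fun Ω hopen hbdd hconn hΩ T hσ O => ⟨fun v _ => ?_, fun ν ρ hν hρ f hf => ?_⟩⟩
  · obtain ⟨w, hw⟩ := O.exists_reconstruction hΩ v
    exact ⟨w, hw, fun w' hw' => O.normalMoments_unique hw'.2 hw.2⟩
  · exact O.existsUnique_solution hn hopen hbdd hconn hΩ hσ hν hρ hf
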